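/- Let $n\ge 1$ and let $\mathcal D_n$ be the group of even-signed permutations: bijections $\pi$ of $\{\pm1,\dots,\pm n\}$ with $\pi(-i)=-\pi(i)$ such that the number of negative entries among $\pi_1,\dots,\pi_n$ (where $\pi_i=\pi(i)$) is even; products are compositions, $(\pi\rho)(i)=\pi(\rho(i))$. Write $|\pi|$ for the permutation $i\mapsto|\pi_i|$ of $[n]=\{1,\dots,n\}$. For $1\le |i|<j\le n$ let $t^D_{ij}=(i\ j)(-i\ {-j})$, and for $1<j\le n$ let $t^D_{-j,j}=(-1\ 1)(-j\ j)$. The length $\ell_D(\pi)$ is the minimal number of factors in an expression of $\pi$ as a product of the generators $t^D_{-1,2}$ (present when $n\ge2$) and $t^D_{i,i+1}$, $1\le i<n$. Every $\pi\in\mathcal D_n$ has a unique factorization $\pi=t^D_{i_1j_1}\cdots t^D_{i_kj_k}$ with $1<j_1<\dots<j_k\le n$, and the sorting index is $\mathsf{sor}_D(\pi)=\sum_{r=1}^k\bigl(j_r-i_r-2\chi(i_r<0)\bigr)$, where $\chi(i_r<0)$ is $1$ if $i_r<0$ and $0$ otherwise. Define the following subsets of $[n]$: - $\mathsf{Rmil}_D^{+}(\pi)$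 is $\{1\}$ together with all $|\pi_i|$ such that $\pi_i>0$ and $|\pi_i|<|\pi_j|$ for all $j>i$; $\mathsf{Rmil}_D^{-}(\pi)$ is the set of all $|\pi_i|\neq1$ such that $\pi_i<0$ and $|\pi_i|<|\pi_j|$ for all $j>i$. - Call a cycle of $|\pi|$ balanced if the number of positions $i$ in it with $\pi_i<0$ is even, and unbalanced otherwise. $\mathsf{Cyc}_D^{+}(\pi)$ is $\{1\}$ together with the smallest elements of all balanced cycles; $\mathsf{Cyc}_D^{-}(\pi)$ is the set of smallest elements of unbalanced cycles, with $1$ removed. - $\mathsf{Lmil}_D(\pi)=\{|\pi_i| : |\pi_i|<|\pi_j| \text{ for all } j<i\}$. - $\mathsf{Lmap}_D(\pi)=\{i : |\pi_i|>|\pi_j| \text{ for all } j<i\}$ and $\mathsf{Lmal}_D(\pi)=\{|\pi_i| : i\in\mathsf{Lmap}_D(\pi)\}$. - $\mathsf{Lmic}_D(\pi)$ is the set of left-to-right minimum letters of the word $|\pi(1)|\,|\pi^2(1)|\,|\pi^3(1)|\cdots$, i.e. $\{|\pi^k(1)| : k\ge1,\ |\pi^k(1)|<|\pi^m(1)|\text{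 for all }1\le m<k\}$. Let $\mathbf f=(f_1,\dots,f_n)$ be integers with $1\le f_1\le f_2\le\cdots\le f_n\le n$, and put $\mathcal D_{n,\mathbf f}=\{\pi\in\mathcal D_n : |\pi_i|\le f_i,\ 1\le i\le n\}$. **Theorem.** The tuples $$(\ell_D,\mathsf{Rmil}_D^{+},\mathsf{Rmil}_D^{-},\mathsf{Lmil}_D,\mathsf{Lmap}_D,\mathsf{Lmal}_D)\quad\text{and}\quad(\mathsf{sor}_D,\mathsf{Cyc}_D^{+},\mathsf{Cyc}_D^{-},\mathsf{Lmic}_D,\mathsf{Lmap}_D,\mathsf{Lmal}_D)$$ have the same joint distribution over $\mathcal D_{n,\mathbf f}$: for every value $v$, the number of $\pi\in\mathcal D_{n,\mathbf f}$ at which the first tuple equals $v$ is the number at which the second tuple equals $v$. -/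

import Mathlib

namespace EvenSigned

/-- The hyperoctahedral group of signed permutations of `{±1, …, ±n}`, with `-i` for the letter `i`
with a bar.  A signed permutation is represented by its extension to `ℤ` that fixes `0` and every
integer of absolute value larger than `n`; the window notation is `π 1, …, π n`, and the product is
composition, `(π * ρ) i = π (ρ i)`. -/
def signedPerm (n : ℕ) : Subgroup (Equiv.Perm ℤ) where
  carrier := {π | (∀ i, π (-i) = -π i) ∧ ∀ i : ℤ, (n : ℤ) < |i| → π i = i}
  mul_mem' := by
    rintro a b ⟨ha, ha'⟩ ⟨hb, hb'⟩
    refine ⟨fun i => by simp [hb, ha], fun i hi => ?_⟩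
    rw [Equiv.Perm.mul_apply, hb' i hi, ha' i hi]
  one_mem' := by simp
  inv_mem' := by
    rintro a ⟨ha, ha'⟩
    refine ⟨fun i => ?_, fun i hi => ?_⟩
    · rw [Equiv.Perm.inv_eq_iff_eq, ha]; simp
    · rw [Equiv.Perm.inv_eq_iff_eq, ha' i hi]

/-- The color of the `i`-th letter: `1` for a negative (barred) letter, `0` otherwise. -/
noncomputable def color (π : Equiv.Perm ℤ) (i : ℤ) : ZMod 2 := if π i < 0 then 1 else 0

/-- The number of negative letters in the window `π 1, …, π n`. -/
noncomputable def negCount (n : ℕ) (π : Equiv.Perm ℤ) : ℕ :=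
  ((Finset.Icc (1 : ℤ) n).filter (fun i => π i < 0)).card

theorem sum_color (n : ℕ) (π : Equiv.Perm ℤ) :
    ∑ i ∈ Finset.Icc (1 : ℤ) n, color π i = (negCount n π : ZMod 2) := by
  simp [color, negCount]

theorem even_negCount_iff (n : ℕ) (π : Equiv.Perm ℤ) :
    Even (negCount n π) ↔ ∑ i ∈ Finset.Icc (1 : ℤ) n, color π i = 0 := by
  rw [sum_color, ZMod.natCast_eq_zero_iff_even]

theorem apply_zero {n : ℕ} {π : Equiv.Perm ℤ} (h : π ∈ signedPerm n) : π 0 = 0 := by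
  have := h.1 0
  simp at this
  omega

theorem abs_mem {n : ℕ} {π : Equiv.Perm ℤ} (h : π ∈ signedPerm n) {i : ℤ}
    (hi : i ∈ Finset.Icc (1 : ℤ) n) : |π i| ∈ Finset.Icc (1 : ℤ) n := by
  rw [Finset.mem_Icc] at *
  have h0 : π i ≠ 0 := fun h' => by
    have := π.injective (h'.trans (apply_zero h).symm)
    omega
  refine ⟨Int.one_le_abs h0, ?_⟩
  by_contra hc
  have h1 := π.injective (h.2 (π i) (by omega))
  rw [h1, abs_of_pos (by omega)] at hc
  omega

theorem color_mul {n : ℕ} {π ρ : Equiv.Perm ℤ} (hπ : π ∈ signedPerm n) (hρ : ρ ∈ signedPerm n)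
    {i : ℤ} (hi : i ∈ Finset.Icc (1 : ℤ) n) : color (π * ρ) i = color π |ρ i| + color ρ i := by
  have h1 := abs_mem hρ hi
  have h2 := abs_mem hπ h1
  simp only [Finset.mem_Icc] at h1 h2
  have h3 : π |ρ i| ≠ 0 := by rintro h; rw [h] at h2; simp at h2
  rcases lt_or_ge (ρ i) 0 with h | h
  · rw [abs_of_neg h, hπ.1] at h3
    have h4 : color ρ i = 1 := if_pos h
    rw [h4, abs_of_neg h]
    rcases lt_or_gt_of_ne h3 with h5 | h5
    · rw [show color (π * ρ) i = 0 from if_neg (by rw [Equiv.Perm.mul_apply]; omega),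
        show color π (-ρ i) = 1 from if_pos (by rw [hπ.1]; omega)]
      decide
    · rw [show color (π * ρ) i = 1 from if_pos (by rw [Equiv.Perm.mul_apply]; omega),
        show color π (-ρ i) = 0 from if_neg (by rw [hπ.1]; omega)]
      decide
  · have h4 : color ρ i = 0 := if_neg (by omega)
    rw [h4, abs_of_nonneg h, add_zero]
    rfl

theorem sum_color_mul {n : ℕ} {π ρ : Equiv.Perm ℤ} (hπ : π ∈ signedPerm n)
    (hρ : ρ ∈ signedPerm n) : ∑ i ∈ Finset.Icc (1 : ℤ) n, color (π * ρ) i =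
      ∑ i ∈ Finset.Icc (1 : ℤ) n, color π i + ∑ i ∈ Finset.Icc (1 : ℤ) n, color ρ i := by
  rw [Finset.sum_congr rfl (fun i hi => color_mul hπ hρ hi), Finset.sum_add_distrib]
  congr 1
  refine Finset.sum_bij (fun i _ => |ρ i|) (fun i hi => abs_mem hρ hi) ?_ ?_ (fun _ _ => rfl)
  · intro a ha b hb hab
    rw [Finset.mem_Icc] at ha hb
    rcases abs_eq_abs.1 hab with h | h
    · exact ρ.injective h
    · rw [← hρ.1] at h
      have := ρ.injective h
      omega
  · intro b hb
    refine ⟨|ρ⁻¹ b|, abs_mem (inv_mem hρ) hb, ?_⟩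
    have hb' := Finset.mem_Icc.1 hb
    rcases abs_choice (ρ⁻¹ b) with h | h <;> rw [h]
    · simp; omega
    · rw [hρ.1]; simp; omega

/-- The even-signed permutation group of rank `n`: an even number of negative letters. -/
def evenSignedPerm (n : ℕ) : Subgroup (Equiv.Perm ℤ) where
  carrier := {π | π ∈ signedPerm n ∧ Even (negCount n π)}
  mul_mem' := by
    rintro a b ⟨ha, ha'⟩ ⟨hb, hb'⟩
    refine ⟨mul_mem ha hb, ?_⟩
    rw [even_negCount_iff] at *
    rw [sum_color_mul ha hb, ha', hb', add_zero]
  one_mem' := by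
    refine ⟨one_mem _, ?_⟩
    have : negCount n 1 = 0 := by
      rw [negCount, Finset.card_eq_zero, Finset.filter_eq_empty_iff]
      intro i hi
      rw [Finset.mem_Icc] at hi
      rw [Equiv.Perm.one_apply]
      omega
    simp [this]
  inv_mem' := by
    rintro a ⟨ha, ha'⟩
    refine ⟨inv_mem ha, ?_⟩
    rw [even_negCount_iff] at *
    have h := sum_color_mul ha (inv_mem ha)
    rw [ha', zero_add] at h
    rw [← h]
    apply Finset.sum_eq_zero
    intro i hi
    rw [Finset.mem_Icc] at hi
    simp [color]
    omega

/-- The element `t^D_{ij}`: it is `(i j)(-i -j)` for `1 ≤ |i| < j`, and `(-1 1)(-j j)` for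
`i = -j`, `1 < j`. -/
def tD (i j : ℤ) : Equiv.Perm ℤ :=
  if i = -j then Equiv.swap (-1) 1 * Equiv.swap (-j) j
  else Equiv.swap i j * Equiv.swap (-i) (-j)

/-- The Coxeter generators of type `D`: `(-1 2)(1 -2)` and the `(i i+1)(-i -(i+1))`, `1 ≤ i < n`. -/
def generators (n : ℕ) : Set (Equiv.Perm ℤ) :=
  {g | (2 ≤ n ∧ g = tD (-1) 2) ∨ ∃ i : ℤ, 1 ≤ i ∧ i < n ∧ g = tD i (i + 1)}

/-- The length `ℓ_D`: the least number of generators whose product is `π`. -/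
noncomputable def length (n : ℕ) (π : Equiv.Perm ℤ) : ℕ :=
  sInf {k | ∃ l : List (Equiv.Perm ℤ), (∀ g ∈ l, g ∈ generators n) ∧ l.prod = π ∧ l.length = k}

/-- The index pairs `(i, j)` of the elements `t^D_{ij}` of rank `n`. -/
def IsIndex (n : ℕ) (p : ℤ × ℤ) : Prop :=
  1 < p.2 ∧ p.2 ≤ n ∧ ((1 ≤ |p.1| ∧ |p.1| < p.2) ∨ p.1 = -p.2)

/-- `π = t^D_{i₁j₁} ⋯ t^D_{iₖjₖ}` with `1 < j₁ < ⋯ < jₖ ≤ n`, where `l = [(i₁,j₁), …, (iₖ,jₖ)]`. -/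
def IsSorting (n : ℕ) (π : Equiv.Perm ℤ) (l : List (ℤ × ℤ)) : Prop :=
  (∀ p ∈ l, IsIndex n p) ∧ l.Pairwise (fun p q => p.2 < q.2) ∧
    (l.map (fun p => tD p.1 p.2)).prod = π

theorem tD_mem {n : ℕ} {i j : ℤ} (h : IsIndex n (i, j)) : tD i j ∈ evenSignedPerm n := by
  obtain ⟨h1, h2, h3⟩ := h
  simp only at h1 h2 h3
  have hs : tD i j ∈ signedPerm n := by
    refine ⟨fun x => ?_, fun x hx => ?_⟩
    · unfold tD
      split_ifs with hc <;> simp only [Equiv.Perm.mul_apply, Equiv.swap_apply_def] <;>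
        grind
    · unfold tD
      split_ifs with hc <;> simp only [Equiv.Perm.mul_apply, Equiv.swap_apply_def] <;>
        grind
  refine ⟨hs, ?_⟩
  rcases h3 with ⟨h3, h4⟩ | h3
  · rcases lt_or_ge i 0 with hi | hi
    · have : (Finset.Icc (1 : ℤ) n).filter (fun x => tD i j x < 0) = {-i, j} := by
        ext x
        simp only [Finset.mem_filter, Finset.mem_Icc, Finset.mem_insert, Finset.mem_singleton]
        unfold tD
        split_ifs with hc <;> simp only [Equiv.Perm.mul_apply, Equiv.swap_apply_def] <;>
          grind
      rw [negCount, this, Finset.card_pair (by grind)]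
      decide
    · have : (Finset.Icc (1 : ℤ) n).filter (fun x => tD i j x < 0) = ∅ := by
        ext x
        simp only [Finset.mem_filter, Finset.mem_Icc, Finset.notMem_empty]
        unfold tD
        split_ifs with hc <;> simp only [Equiv.Perm.mul_apply, Equiv.swap_apply_def] <;>
          grind
      rw [negCount, this]
      simp
  · have : (Finset.Icc (1 : ℤ) n).filter (fun x => tD i j x < 0) = {1, j} := by
      ext x
      simp only [Finset.mem_filter, Finset.mem_Icc, Finset.mem_insert, Finset.mem_singleton]
      unfold tD
      split_ifs with hc <;> simp only [Equiv.Perm.mul_apply, Equiv.swap_apply_def] <;>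
        grind
    rw [negCount, this, Finset.card_pair (by grind)]
    decide

theorem tD_apply_right {n : ℕ} {i j : ℤ} (h : IsIndex n (i, j)) : tD i j j = i := by
  obtain ⟨h1, h2, h3⟩ := h
  simp only at h1 h2 h3
  unfold tD
  split_ifs <;> simp only [Equiv.Perm.mul_apply, Equiv.swap_apply_def] <;> grind

theorem tD_mul_self {n : ℕ} {i j : ℤ} (h : IsIndex n (i, j)) : tD i j * tD i j = 1 := by
  obtain ⟨h1, h2, h3⟩ := h
  simp only at h1 h2 h3
  ext x
  unfold tD
  split_ifs with hc <;>
    simp only [Equiv.Perm.mul_apply, Equiv.swap_apply_def, Equiv.Perm.one_apply] <;> grind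

theorem IsIndex.mono {n : ℕ} {p : ℤ × ℤ} (h : IsIndex n p) : IsIndex (n + 1) p :=
  ⟨h.1, by have := h.2.1; push_cast; omega, h.2.2⟩

theorem IsSorting.mem {n : ℕ} {π : Equiv.Perm ℤ} {l : List (ℤ × ℤ)} (h : IsSorting n π l) :
    π ∈ evenSignedPerm n := by
  rw [← h.2.2]
  apply Subgroup.list_prod_mem
  intro g hg
  obtain ⟨p, hp, rfl⟩ := List.mem_map.1 hg
  exact tD_mem (h.1 p hp)

theorem apply_top {n : ℕ} {π : Equiv.Perm ℤ} (h : π ∈ evenSignedPerm n) :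
    π ((n : ℤ) + 1) = (n : ℤ) + 1 :=
  h.1.2 _ (by rw [abs_of_pos] <;> omega)

theorem mem_of_apply_top {n : ℕ} {π : Equiv.Perm ℤ} (h : π ∈ evenSignedPerm (n + 1))
    (ht : π ((n : ℤ) + 1) = (n : ℤ) + 1) : π ∈ evenSignedPerm n := by
  refine ⟨⟨h.1.1, fun i hi => ?_⟩, ?_⟩
  · by_cases hc : (n : ℤ) + 1 < |i|
    · exact h.1.2 i (by push_cast; exact hc)
    · have : |i| = (n : ℤ) + 1 := by omega
      rcases abs_choice i with h' | h'
      · rw [show i = (n : ℤ) + 1 by omega, ht]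
      · rw [show i = -((n : ℤ) + 1) by omega, h.1.1, ht]
  · have h2 := h.2
    have : negCount (n + 1) π = negCount n π := by
      unfold negCount
      congr 1
      ext x
      simp only [Finset.mem_filter, Finset.mem_Icc]
      push_cast
      constructor
      · rintro ⟨⟨a, b⟩, c⟩
        refine ⟨⟨a, ?_⟩, c⟩
        by_contra hx
        rw [show x = (n : ℤ) + 1 by omega, ht] at c
        omega
      · rintro ⟨⟨a, b⟩, c⟩
        exact ⟨⟨a, by omega⟩, c⟩
    rwa [this] at h2

theorem isSorting_concat {n : ℕ} {π : Equiv.Perm ℤ} {l : List (ℤ × ℤ)} {i : ℤ}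
    (hi : IsIndex (n + 1) (i, (n : ℤ) + 1)) (h : IsSorting n (π * tD i ((n : ℤ) + 1)) l) :
    IsSorting (n + 1) π (l ++ [(i, (n : ℤ) + 1)]) := by
  refine ⟨?_, ?_, ?_⟩
  · intro p hp
    rcases List.mem_append.1 hp with hp | hp
    · exact (h.1 p hp).mono
    · rw [List.mem_singleton.1 hp]; exact hi
  · rw [List.pairwise_append]
    refine ⟨h.2.1, by simp, fun a ha b hb => ?_⟩
    rw [List.mem_singleton.1 hb]
    have := (h.1 a ha).2.1
    simp only
    omega
  · rw [List.map_append, List.prod_append, h.2.2]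
    simp [mul_assoc, tD_mul_self hi]

theorem isSorting_cases {n : ℕ} {π : Equiv.Perm ℤ} {l : List (ℤ × ℤ)}
    (h : IsSorting (n + 1) π l) : IsSorting n π l ∨ ∃ i l', l = l' ++ [(i, (n : ℤ) + 1)] ∧
      IsIndex (n + 1) (i, (n : ℤ) + 1) ∧ IsSorting n (π * tD i ((n : ℤ) + 1)) l' := by
  rcases List.eq_nil_or_concat l with rfl | ⟨l', ⟨i, j⟩, rfl⟩
  · left
    exact ⟨by simp, by simp, h.2.2⟩
  · rw [List.concat_eq_append] at *
    have hp := List.pairwise_append.1 h.2.1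
    have hij := h.1 (i, j) (by simp)
    have hj := hij.2.1
    simp only [Nat.cast_add, Nat.cast_one] at hj
    have hl : ∀ p ∈ l', IsIndex n p := fun p hp' => by
      have h1 := h.1 p (by simp [hp'])
      have h2 := hp.2.2 p hp' (i, j) (by simp)
      simp only at h2
      exact ⟨h1.1, by omega, h1.2.2⟩
    by_cases hc : j = (n : ℤ) + 1
    · right
      subst hc
      refine ⟨i, l', rfl, hij, hl, hp.1, ?_⟩
      have h3 := h.2.2
      rw [List.map_append, List.prod_append] at h3
      rw [← h3]
      simp [mul_assoc, tD_mul_self hij]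
    · left
      refine ⟨fun p hp' => ?_, h.2.1, h.2.2⟩
      rcases List.mem_append.1 hp' with hp' | hp'
      · exact hl p hp'
      · rw [List.mem_singleton.1 hp']
        exact ⟨hij.1, by simp only; omega, hij.2.2⟩

theorem IsSorting.inv_apply {n : ℕ} {π : Equiv.Perm ℤ} {l : List (ℤ × ℤ)} {i : ℤ}
    (hi : IsIndex (n + 1) (i, (n : ℤ) + 1)) (h : IsSorting n (π * tD i ((n : ℤ) + 1)) l) :
    π⁻¹ ((n : ℤ) + 1) = i := by
  have h1 := apply_top h.mem
  rw [Equiv.Perm.mul_apply, tD_apply_right hi] at h1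
  rw [Equiv.Perm.inv_eq_iff_eq, h1]

/-- Every even-signed permutation has exactly one sorting factorization. -/
theorem existsUnique_isSorting (n : ℕ) {π : Equiv.Perm ℤ} (h : π ∈ evenSignedPerm n) :
    ∃! l, IsSorting n π l := by
  induction n generalizing π with
  | zero =>
    have h1 : π = 1 := by
      ext x
      by_cases hx : x = 0
      · rw [hx]; exact apply_zero h.1
      · exact h.1.2 x (by simpa using hx)
    refine ⟨[], ⟨by simp, by simp, by simp [h1]⟩, fun l hl => ?_⟩
    refine List.eq_nil_iff_forall_not_mem.2 fun p hp => ?_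
    have := hl.1 p hp
    have h2 := this.1
    have h3 := this.2.1
    simp at h3
    omega
  | succ n ih =>
    by_cases ht : π ((n : ℤ) + 1) = (n : ℤ) + 1
    · obtain ⟨l, hl, hu⟩ := ih (mem_of_apply_top h ht)
      refine ⟨l, ⟨fun p hp => (hl.1 p hp).mono, hl.2⟩, fun l' hl' => ?_⟩
      rcases isSorting_cases hl' with h1 | ⟨i, l'', rfl, hi, h1⟩
      · exact hu l' h1
      · have h2 := h1.inv_apply hi
        rw [Equiv.Perm.inv_eq_iff_eq] at h2
        have h3 := π.injective (ht.trans h2)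
        obtain ⟨h4, h5, h6⟩ := hi
        simp only at h4 h5 h6
        grind
    · set i := π⁻¹ ((n : ℤ) + 1) with hidef
      have hπi : π i = (n : ℤ) + 1 := by simp [hidef]
      have hne : i ≠ (n : ℤ) + 1 := fun h' => ht (by rw [← h', hπi, h'])
      have hle : |i| ≤ (n : ℤ) + 1 := by
        by_contra hc
        have := h.1.2 i (by push_cast; omega)
        rw [hπi] at this
        exact hne this.symm
      have h0 : i ≠ 0 := by
        intro h'
        rw [h', apply_zero h.1] at hπi
        omega
      have hn : n ≠ 0 := by
        rintro rfl
        have h2 := h.2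
        have hm : i = -1 := by
          simp at hle hne
          grind
        have h3 : π 1 = -1 := by
          have := h.1.1 (-1)
          rw [← hm, hπi] at this
          simpa [hm] using this
        simp [negCount, Finset.filter_singleton, h3] at h2
      have hi : IsIndex (n + 1) (i, (n : ℤ) + 1) := by
        refine ⟨?_, by push_cast; simp, ?_⟩
        · simp only; omega
        · simp only
          grind
      have hmem : π * tD i ((n : ℤ) + 1) ∈ evenSignedPerm n :=
        mem_of_apply_top (mul_mem h (tD_mem hi))
          (by rw [Equiv.Perm.mul_apply, tD_apply_right hi, hπi])
      obtain ⟨l, hl, hu⟩ := ih hmem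
      refine ⟨l ++ [(i, (n : ℤ) + 1)], isSorting_concat hi hl, fun l' hl' => ?_⟩
      rcases isSorting_cases hl' with h1 | ⟨k, l'', rfl, hk, h1⟩
      · exact absurd (apply_top h1.mem) ht
      · have h2 := h1.inv_apply hk
        rw [← hidef] at h2
        subst h2
        rw [hu l'' h1]

open Classical in
/-- The sorting index `sor_D`: the sum of `j - i - 2χ(i < 0)` over the factors `t^D_{ij}` of the
unique sorting factorization of `π` (and `0` by convention if `π` is not even-signed). -/
noncomputable def sorD (n : ℕ) (π : Equiv.Perm ℤ) : ℤ :=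
  if h : ∃ l, IsSorting n π l then
    (h.choose.map (fun p => p.2 - p.1 - 2 * (if p.1 < 0 then 1 else 0))).sum
  else 0

/-- Letters (in absolute value) of color `t` that are right-to-left minima of `|π 1|, …, |π n|`. -/
def Rmil (n : ℕ) (t : ZMod 2) (π : Equiv.Perm ℤ) : Set ℤ :=
  {a | ∃ i : ℤ, 1 ≤ i ∧ i ≤ n ∧ (∀ j : ℤ, i < j → j ≤ n → |π i| < |π j|) ∧
    color π i = t ∧ |π i| = a}

/-- The orbit of `a` under iteration of `|π|`, that is, the underlying set of its cycle. -/
def absCycle (π : Equiv.Perm ℤ) (a : ℤ) : Set ℤ := {b | ∃ k : ℕ, (fun x => |π x|)^[k] a = b}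

open Classical in
/-- Smallest numbers of the cycles of `|π|` whose letters have colors of sum `t`. -/
def Cyc (n : ℕ) (t : ZMod 2) (π : Equiv.Perm ℤ) : Set ℤ :=
  {a | 1 ≤ a ∧ a ≤ n ∧ (∀ b ∈ absCycle π a, a ≤ b) ∧
    ∑ i ∈ (Finset.Icc (1 : ℤ) n).filter (fun i => i ∈ absCycle π a), color π i = t}

def RmilPlus (n : ℕ) (π : Equiv.Perm ℤ) : Set ℤ := Rmil n 0 π ∪ {1}

def RmilMinus (n : ℕ) (π : Equiv.Perm ℤ) : Set ℤ := Rmil n 1 π \ {1}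

def CycPlus (n : ℕ) (π : Equiv.Perm ℤ) : Set ℤ := Cyc n 0 π ∪ {1}

def CycMinus (n : ℕ) (π : Equiv.Perm ℤ) : Set ℤ := Cyc n 1 π \ {1}

/-- Left-to-right minimum letters of `|π 1|, …, |π n|`. -/
def Lmil (n : ℕ) (π : Equiv.Perm ℤ) : Set ℤ :=
  {a | ∃ i : ℤ, 1 ≤ i ∧ i ≤ n ∧ (∀ j : ℤ, 1 ≤ j → j < i → |π i| < |π j|) ∧ |π i| = a}

/-- Left-to-right maximum letters of `|π 1|, …, |π n|`. -/
def Lmal (n : ℕ) (π : Equiv.Perm ℤ) : Set ℤ :=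
  {a | ∃ i : ℤ, 1 ≤ i ∧ i ≤ n ∧ (∀ j : ℤ, 1 ≤ j → j < i → |π j| < |π i|) ∧ |π i| = a}

/-- Left-to-right maximum places of `|π 1|, …, |π n|`. -/
def Lmap (n : ℕ) (π : Equiv.Perm ℤ) : Set ℤ :=
  {i | 1 ≤ i ∧ i ≤ n ∧ ∀ j : ℤ, 1 ≤ j → j < i → |π j| < |π i|}

/-- Left-to-right minimum letters of the word `|π 1|, |π (π 1)|, |π (π (π 1))|, …`. -/
def Lmic (π : Equiv.Perm ℤ) : Set ℤ :=
  {a | ∃ k : ℕ, 1 ≤ k ∧ (∀ m : ℕ, 1 ≤ m → m < k → |(π ^ k) 1| < |(π ^ m) 1|) ∧ |(π ^ k) 1| = a}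

/-- Even-signed permutations restricted to the Ferrers shape with row lengths `f 1, …, f n`. -/
def restricted (n : ℕ) (f : ℤ → ℤ) : Set (Equiv.Perm ℤ) :=
  {π | π ∈ evenSignedPerm n ∧ ∀ i : ℤ, 1 ≤ i → i ≤ n → |π i| ≤ f i}

end EvenSigned

/-! Write `N = n + 1`. An element of `D_N` amounts to an element `σ` of `D_n` together with the
preimage `i` of `N`, and this correspondence can be set up in two ways. On words, `N` with the sign
of `i` is inserted at place `|i|` of the word of `σ`; if `i < 0`, the letter `±1` changes sign as
well, which keeps the number of negative letters even (`insertTop`). On cycles, `σ` is multiplied on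
the right by `t^D_{iN}`, which is the identity for `i = N` and otherwise the last factor of the
sorting factorization.

Under the first construction the length statistics, and under the second the sorting statistics,
change by the same rule `addTop`, which depends only on `N` and `i` (`lengthStats_insert`,
`sortingStats_mul_tD`). The forced sign change affects only the letter `1` in the first case, and
only the cycle of `1` in the second. This is why `1` is put into the positive sets and removed from
the negative ones. For the numerical statistic, the length is first rewritten as a count of pairs
(`length_eq_invD`), in which the sign of `±1` plays no role.

Since the two statistics agree on the trivial group `D_1`, induction gives a bijection of `D_n`
carrying one tuple to the other (`exists_bijOn_stats`). It preserves the left-to-right maxima as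
place-letter pairs. As `f` is weakly increasing, these pairs decide membership in the restricted set
(`mem_restricted_iff`), so the bijection restricts to it. -/

namespace EvenSigned

/-! ### The length as a count of pairs -/

/-- The contribution to the length of two letters `a`, `b` at positions in increasing order. -/
def pairWeight (a b : ℤ) : ℤ := (if b < a then 1 else 0) + (if b < -a then 1 else 0)

/-- The number of pairs `i < j` with `π i > π j`, plus that of pairs with `π i + π j < 0`. -/
noncomputable def invD (n : ℕ) (π : Equiv.Perm ℤ) : ℤ :=
  ∑ i ∈ Finset.Icc (1 : ℤ) n, ∑ j ∈ Finset.Icc (1 : ℤ) n,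
    if i < j then pairWeight (π i) (π j) else 0

theorem pairWeight_nonneg (a b : ℤ) : 0 ≤ pairWeight a b := by
  unfold pairWeight; split_ifs <;> simp

theorem pairWeight_neg_left (a b : ℤ) : pairWeight (-a) b = pairWeight a b := by
  unfold pairWeight; rw [neg_neg, add_comm]

/-- The sign of `a` never matters, and that of `b` matters only if `b` is the larger in absolute
value. Among nonzero letters of distinct absolute values, the sign of `±1` is therefore irrelevant.
-/
theorem pairWeight_eq {a b : ℤ} (h : |a| ≠ |b|) :
    pairWeight a b = (if |b| < |a| then 1 else 0) + (if b < 0 ∧ |a| < |b| then 2 else 0) := by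
  unfold pairWeight; grind

theorem invD_nonneg (n : ℕ) (π : Equiv.Perm ℤ) : 0 ≤ invD n π := by
  refine Finset.sum_nonneg fun i _ => Finset.sum_nonneg fun j _ => ?_
  split_ifs
  exacts [pairWeight_nonneg _ _, le_rfl]

theorem invD_one (n : ℕ) : invD n 1 = 0 := by
  refine Finset.sum_eq_zero fun i hi => Finset.sum_eq_zero fun j hj => ?_
  rw [Finset.mem_Icc] at hi hj
  simp only [Equiv.Perm.one_apply, pairWeight]
  grind

theorem tD_apply_of_pos {i j x : ℤ} (hi : 1 ≤ i) (hij : i < j) (hx : 1 ≤ x) :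
    tD i j x = Equiv.swap i j x := by
  unfold tD
  split_ifs <;> simp only [Equiv.Perm.mul_apply, Equiv.swap_apply_def] <;> grind

theorem sum_Icc_swap {n : ℕ} {i j : ℤ} (hi : i ∈ Finset.Icc (1 : ℤ) n)
    (hj : j ∈ Finset.Icc (1 : ℤ) n) (g : ℤ → ℤ) :
    ∑ x ∈ Finset.Icc (1 : ℤ) n, g (Equiv.swap i j x) = ∑ x ∈ Finset.Icc (1 : ℤ) n, g x := by
  refine Finset.sum_equiv (Equiv.swap i j) (fun x => ?_) (fun _ _ => rfl)
  rw [Equiv.swap_apply_def]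
  split_ifs with h1 h2
  · rw [h1]; simp [hi, hj]
  · rw [h2]; simp [hi, hj]
  · rfl

/-- Exchanging adjacent places reverses the order of that one pair of places and of no other. -/
theorem invD_mul_tD_succ {n : ℕ} (π : Equiv.Perm ℤ) {s : ℤ} (h1 : 1 ≤ s) (h2 : s < n) :
    invD n (π * tD s (s + 1)) = invD n π + pairWeight (π (s + 1)) (π s)
      - pairWeight (π s) (π (s + 1)) := by
  have hs : s ∈ Finset.Icc (1 : ℤ) n := by simp; omega
  have hs' : s + 1 ∈ Finset.Icc (1 : ℤ) n := by simp; omega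
  set t := Equiv.swap s (s + 1) with ht
  -- Reindexing both sums by the transposition moves it from the letters to the order condition.
  have hL : invD n (π * tD s (s + 1)) = ∑ i ∈ Finset.Icc (1 : ℤ) n, ∑ j ∈ Finset.Icc (1 : ℤ) n,
      if t i < t j then pairWeight (π i) (π j) else 0 := by
    refine Eq.trans (Finset.sum_congr rfl fun i hi => Eq.trans
      (Finset.sum_congr rfl fun j hj => ?_) (sum_Icc_swap hs hs'
        fun j => if t (t i) < t j then pairWeight (π (t i)) (π j) else 0))
      (sum_Icc_swap hs hs' fun i => ∑ j ∈ Finset.Icc (1 : ℤ) n,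
        if t i < t j then pairWeight (π i) (π j) else 0)
    rw [Finset.mem_Icc] at hi hj
    rw [Equiv.Perm.mul_apply, Equiv.Perm.mul_apply, tD_apply_of_pos h1 (by omega) hi.1,
      tD_apply_of_pos h1 (by omega) hj.1]
    simp [ht]
  have hd : ∑ i ∈ Finset.Icc (1 : ℤ) n, ∑ j ∈ Finset.Icc (1 : ℤ) n,
      ((if t i < t j then pairWeight (π i) (π j) else 0)
        - if i < j then pairWeight (π i) (π j) else 0) =
      ∑ i ∈ Finset.Icc (1 : ℤ) n, ∑ j ∈ Finset.Icc (1 : ℤ) n,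
      ((if i = s + 1 then if j = s then pairWeight (π (s + 1)) (π s) else 0 else 0) -
       (if i = s then if j = s + 1 then pairWeight (π s) (π (s + 1)) else 0 else 0)) := by
    refine Finset.sum_congr rfl fun i hi => Finset.sum_congr rfl fun j hj => ?_
    rw [ht]
    simp only [Equiv.swap_apply_def]
    grind
  have hr : ∑ i ∈ Finset.Icc (1 : ℤ) n, ∑ j ∈ Finset.Icc (1 : ℤ) n,
      ((if i = s + 1 then if j = s then pairWeight (π (s + 1)) (π s) else 0 else 0) -
       (if i = s then if j = s + 1 then pairWeight (π s) (π (s + 1)) else 0 else 0)) =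
      pairWeight (π (s + 1)) (π s) - pairWeight (π s) (π (s + 1)) := by
    simp only [Finset.sum_sub_distrib]
    congr 1
    · rw [Finset.sum_eq_single_of_mem _ hs' (fun i _ h => by simp [h]),
        Finset.sum_eq_single_of_mem _ hs (fun i _ h => by simp [h])]
      simp
    · rw [Finset.sum_eq_single_of_mem _ hs (fun i _ h => by simp [h]),
        Finset.sum_eq_single_of_mem _ hs' (fun i _ h => by simp [h])]
      simp
  rw [hr] at hd
  simp only [Finset.sum_sub_distrib] at hd
  rw [hL]
  unfold invD
  linarith

theorem tD_neg_one_two_apply {x : ℤ} (hx : 1 ≤ x) :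
    tD (-1) 2 x = if x = 1 then -2 else if x = 2 then -1 else x := by
  unfold tD
  split_ifs <;> simp only [Equiv.Perm.mul_apply, Equiv.swap_apply_def] <;> grind

/-- The result is compared with `π * tD 1 2`, whose word differs only in the signs of the first two
letters. By `pairWeight_neg_left` these signs do not matter against any later letter, so only the
pair of places `(1, 2)` contributes to the difference. -/
theorem invD_mul_tD_neg {n : ℕ} {π : Equiv.Perm ℤ} (hπ : π ∈ signedPerm n) (hn : 2 ≤ n) :
    invD n (π * tD (-1) 2) = invD n π + pairWeight (-π 2) (-π 1) - pairWeight (π 1) (π 2) := by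
  have hm1 : (1 : ℤ) ∈ Finset.Icc (1 : ℤ) n := by simp; omega
  have hm2 : (2 : ℤ) ∈ Finset.Icc (1 : ℤ) n := by simp; omega
  have h := invD_mul_tD_succ π (n := n) (s := 1) le_rfl (by omega)
  norm_num at h
  have hd : ∑ i ∈ Finset.Icc (1 : ℤ) n, ∑ j ∈ Finset.Icc (1 : ℤ) n,
      ((if i < j then pairWeight ((π * tD (-1) 2) i) ((π * tD (-1) 2) j) else 0)
        - if i < j then pairWeight ((π * tD 1 2) i) ((π * tD 1 2) j) else 0) =
      ∑ i ∈ Finset.Icc (1 : ℤ) n, ∑ j ∈ Finset.Icc (1 : ℤ) n,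
      (if i = 1 then if j = 2 then pairWeight (-π 2) (-π 1) - pairWeight (π 2) (π 1)
        else 0 else 0) := by
    refine Finset.sum_congr rfl fun i hi => Finset.sum_congr rfl fun j hj => ?_
    rw [Finset.mem_Icc] at hi hj
    simp only [Equiv.Perm.mul_apply, tD_neg_one_two_apply hi.1, tD_neg_one_two_apply hj.1,
      tD_apply_of_pos (i := 1) (j := 2) (by norm_num) (by norm_num) hi.1,
      tD_apply_of_pos (i := 1) (j := 2) (by norm_num) (by norm_num) hj.1, Equiv.swap_apply_def]
    have e1 := hπ.1 1
    have e2 := hπ.1 2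
    have e3 := pairWeight_neg_left (π 1) (π j)
    have e4 := pairWeight_neg_left (π 2) (π j)
    grind
  have hr : ∑ i ∈ Finset.Icc (1 : ℤ) n, ∑ j ∈ Finset.Icc (1 : ℤ) n,
      (if i = 1 then if j = 2 then pairWeight (-π 2) (-π 1) - pairWeight (π 2) (π 1)
        else 0 else 0) = pairWeight (-π 2) (-π 1) - pairWeight (π 2) (π 1) := by
    rw [Finset.sum_eq_single_of_mem _ hm1 (fun i _ h => by simp [h]),
      Finset.sum_eq_single_of_mem _ hm2 (fun i _ h => by simp [h])]
    simp
  rw [hr] at hd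
  simp only [Finset.sum_sub_distrib] at hd
  have : invD n (π * tD (-1) 2) - invD n (π * tD 1 2) =
    pairWeight (-π 2) (-π 1) - pairWeight (π 2) (π 1) := hd
  linarith

/-- With `pairWeight_neg_swap_sub`, this shows that a generator changes `invD` by exactly one,
downwards precisely at a descent. -/
theorem pairWeight_swap_sub {a b : ℤ} (h : a ≠ b) :
    pairWeight b a - pairWeight a b = if b < a then -1 else 1 := by
  unfold pairWeight; grind

theorem pairWeight_neg_swap_sub {a b : ℤ} (h : a ≠ -b) :
    pairWeight (-b) (-a) - pairWeight a b = if a + b < 0 then -1 else 1 := by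
  unfold pairWeight; grind

theorem apply_ne_neg_apply {n : ℕ} {π : Equiv.Perm ℤ} (hπ : π ∈ signedPerm n) {x y : ℤ}
    (h : x ≠ -y) : π x ≠ -π y := by
  rw [← hπ.1]
  exact fun e => h (π.injective e)

theorem generators_mem {n : ℕ} {g : Equiv.Perm ℤ} (hg : g ∈ generators n) :
    g ∈ evenSignedPerm n := by
  rcases hg with ⟨h, rfl⟩ | ⟨i, h1, h2, rfl⟩
  · exact tD_mem ⟨by norm_num, by simpa using h, by norm_num⟩
  · exact tD_mem ⟨by simp only; omega, by simp only; omega,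
      Or.inl ⟨by rw [abs_of_pos] <;> omega, by simp only; rw [abs_of_pos] <;> omega⟩⟩

theorem generators_mul_self {n : ℕ} {g : Equiv.Perm ℤ} (hg : g ∈ generators n) : g * g = 1 := by
  rcases hg with ⟨h, rfl⟩ | ⟨i, h1, h2, rfl⟩
  · exact tD_mul_self (n := n) ⟨by norm_num, by simpa using h, by norm_num⟩
  · exact tD_mul_self (n := n) ⟨by simp only; omega, by simp only; omega,
      Or.inl ⟨by rw [abs_of_pos] <;> omega, by simp only; rw [abs_of_pos] <;> omega⟩⟩

theorem invD_mul_generator_le {n : ℕ} {π g : Equiv.Perm ℤ} (hπ : π ∈ signedPerm n)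
    (hg : g ∈ generators n) : invD n (π * g) ≤ invD n π + 1 := by
  rcases hg with ⟨h, rfl⟩ | ⟨i, h1, h2, rfl⟩
  · rw [invD_mul_tD_neg hπ h]
    have := pairWeight_neg_swap_sub (apply_ne_neg_apply hπ (x := 1) (y := 2) (by norm_num))
    split_ifs at this <;> omega
  · rw [invD_mul_tD_succ π h1 h2]
    have := pairWeight_swap_sub (a := π i) (b := π (i + 1)) (by simp)
    split_ifs at this <;> omega

theorem apply_one_pos {n : ℕ} {π : Equiv.Perm ℤ} (hπ : π ∈ evenSignedPerm n) (hn : 1 ≤ n)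
    (h : ∀ x : ℤ, 2 ≤ x → x ≤ n → 0 < π x) : 0 < π 1 := by
  by_contra hc
  have h0 : π 1 ≠ 0 := fun h' => by
    have := π.injective (h'.trans (apply_zero hπ.1).symm)
    omega
  have h2 := hπ.2
  have : (Finset.Icc (1 : ℤ) n).filter (fun i => π i < 0) = {1} := by
    ext x
    simp only [Finset.mem_filter, Finset.mem_Icc, Finset.mem_singleton]
    constructor
    · rintro ⟨⟨h3, h4⟩, h5⟩
      by_contra hx
      have := h x (by omega) h4
      omega
    · rintro rfl
      exact ⟨⟨le_rfl, by exact_mod_cast hn⟩, by omega⟩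
  rw [negCount, this] at h2
  simp at h2

/-- With no descent, the word increases and its letters are positive from place 2 on; parity then
makes the first letter positive too. An increasing word of positive letters bounded by `n` is the
identity. For `n = 1`, parity alone suffices. -/
theorem eq_one_of_forall_lt {n : ℕ} {π : Equiv.Perm ℤ} (hπ : π ∈ evenSignedPerm n)
    (h : ∀ s : ℤ, 1 ≤ s → s < n → π s < π (s + 1)) (h2 : 2 ≤ n → 0 < π 1 + π 2) : π = 1 := by
  have hp2 : ∀ x : ℤ, 2 ≤ x → x ≤ n → 0 < π x := by
    intro x hx
    induction x, hx using Int.leInduction with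
    | base =>
      intro hn
      have h3 := h 1 le_rfl (by omega)
      have h4 := h2 (by omega)
      norm_num at h3
      omega
    | succ x hx ih =>
      intro hn
      have := h x (by omega) (by omega)
      have := ih (by omega)
      omega
  have hge : ∀ x : ℤ, 1 ≤ x → x ≤ n → x ≤ π x := by
    intro x hx
    induction x, hx using Int.leInduction with
    | base =>
      intro hn
      exact apply_one_pos hπ (by omega) hp2
    | succ x hx ih =>
      intro hn
      have := h x (by omega) (by omega)
      have := ih (by omega)
      omega
  -- Downward induction on the place, with `d = n - x`.
  have hle : ∀ d : ℕ, ∀ x : ℤ, 1 ≤ x → x + d = n → π x ≤ x := by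
    intro d
    induction d with
    | zero =>
      intro x hx hxn
      have := (Finset.mem_Icc.1 (abs_mem hπ.1 (i := x) (by simp; omega))).2
      have := le_abs_self (π x)
      omega
    | succ d ih =>
      intro x hx hxn
      have h1 := ih (x + 1) (by omega) (by push_cast at hxn; omega)
      have h3 := h x hx (by omega)
      omega
  have hpos : ∀ x : ℤ, 1 ≤ x → π x = x := by
    intro x hx
    by_cases hxn : x ≤ n
    · exact le_antisymm (hle (n - x).toNat x hx (by omega)) (hge x hx hxn)
    · exact hπ.1.2 x (by rw [abs_of_pos] <;> omega)
  ext x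
  rw [Equiv.Perm.one_apply]
  rcases lt_trichotomy x 0 with hx | hx | hx
  · have h1 := hπ.1.1 (-x)
    rw [neg_neg, hpos (-x) (by omega)] at h1
    omega
  · rw [hx, apply_zero hπ.1]
  · exact hpos x (by omega)

theorem exists_generator_invD_lt {n : ℕ} {π : Equiv.Perm ℤ} (hπ : π ∈ evenSignedPerm n)
    (h1 : π ≠ 1) : ∃ g ∈ generators n, invD n (π * g) = invD n π - 1 := by
  by_contra! hc
  refine h1 (eq_one_of_forall_lt hπ (fun s hs hsn => ?_) (fun hn => ?_))
  · have h2 := hc _ (Or.inr ⟨s, hs, hsn, rfl⟩)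
    rw [invD_mul_tD_succ π hs hsn] at h2
    have h3 : π s ≠ π (s + 1) := by simp
    have := pairWeight_swap_sub h3
    split_ifs at this <;> omega
  · have h2 := hc _ (Or.inl ⟨hn, rfl⟩)
    rw [invD_mul_tD_neg hπ.1 hn] at h2
    have h3 := apply_ne_neg_apply hπ.1 (x := 1) (y := 2) (by norm_num)
    have := pairWeight_neg_swap_sub h3
    split_ifs at this <;> omega

theorem exists_word_of_invD {n : ℕ} (m : ℕ) {π : Equiv.Perm ℤ} (hπ : π ∈ evenSignedPerm n)
    (hm : invD n π = m) :
    ∃ l : List (Equiv.Perm ℤ), (∀ g ∈ l, g ∈ generators n) ∧ l.prod = π ∧ l.length = m := by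
  induction m generalizing π with
  | zero =>
    refine ⟨[], by simp, ?_, rfl⟩
    by_contra h
    obtain ⟨g, -, h2⟩ := exists_generator_invD_lt hπ (fun e => h (by rw [e]; rfl))
    have := invD_nonneg n (π * g)
    push_cast at hm
    omega
  | succ m ih =>
    have h1 : π ≠ 1 := by
      rintro rfl
      rw [invD_one] at hm
      push_cast at hm
      omega
    obtain ⟨g, hg, h2⟩ := exists_generator_invD_lt hπ h1
    obtain ⟨l, hl, hl2, hl3⟩ := ih (mul_mem hπ (generators_mem hg)) (by push_cast at hm; omega)
    refine ⟨l ++ [g], ?_, ?_, by simp [hl3]⟩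
    · intro x hx
      rcases List.mem_append.1 hx with hx | hx
      · exact hl x hx
      · rw [List.mem_singleton.1 hx]; exact hg
    · rw [List.prod_append, hl2, List.prod_singleton, mul_assoc, generators_mul_self hg, mul_one]

theorem invD_prod_le {n : ℕ} (l : List (Equiv.Perm ℤ)) (hl : ∀ g ∈ l, g ∈ generators n) :
    invD n l.prod ≤ l.length := by
  induction l using List.reverseRecOn with
  | nil => simp [invD_one]
  | append_singleton l g ih =>
    have h1 := ih (fun x hx => hl x (by simp [hx]))
    have h2 : l.prod ∈ evenSignedPerm n :=
      Subgroup.list_prod_mem _ fun x hx => generators_mem (hl x (by simp [hx]))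
    have h3 := invD_mul_generator_le h2.1 (hl g (by simp))
    rw [List.prod_append, List.prod_singleton, List.length_append, List.length_singleton]
    push_cast
    omega

theorem length_eq_invD {n : ℕ} {π : Equiv.Perm ℤ} (hπ : π ∈ evenSignedPerm n) :
    (length n π : ℤ) = invD n π := by
  obtain ⟨m, hm⟩ := Int.eq_ofNat_of_zero_le (invD_nonneg n π)
  have hw := exists_word_of_invD m hπ hm
  refine le_antisymm ?_ ?_
  · rw [hm]
    exact_mod_cast Nat.sInf_le hw
  · obtain ⟨l, hl, hl2, hl3⟩ := Nat.sInf_mem (s := {k | ∃ l : List (Equiv.Perm ℤ),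
      (∀ g ∈ l, g ∈ generators n) ∧ l.prod = π ∧ l.length = k}) ⟨m, hw⟩
    have := invD_prod_le l hl
    rw [hl2, hl3] at this
    exact this

/-! ### The two tuples of statistics and their common recursion -/

/-- The left-to-right maxima of `|π 1|, …, |π n|`, as pairs of a place and a letter. -/
def lrMaxPairs (n : ℕ) (π : Equiv.Perm ℤ) : Set (ℤ × ℤ) :=
  {p | 1 ≤ p.1 ∧ p.1 ≤ n ∧ (∀ j : ℤ, 1 ≤ j → j < p.1 → |π j| < |π p.1|) ∧ |π p.1| = p.2}

/-- The effect on the statistics of adding the letter `N`, where `i` is the preimage of `N`. -/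
def addTop (N i : ℤ) (s : ℤ × Set ℤ × Set ℤ × Set ℤ × Set (ℤ × ℤ)) :
    ℤ × Set ℤ × Set ℤ × Set ℤ × Set (ℤ × ℤ) :=
  (s.1 + (N - i - 2 * (if i < 0 then 1 else 0)), s.2.1 ∪ {a | a = N ∧ i = N},
    s.2.2.1 ∪ {a | a = N ∧ i = -N}, s.2.2.2.1 ∪ {a | a = N ∧ |i| = 1},
    {p | p ∈ s.2.2.2.2 ∧ p.1 < |i|} ∪ {(|i|, N)})

/-- `invD` stands for the length, with which it agrees on the group. The left-to-right maxima are
kept as pairs because the shape condition compares each letter with its own place. -/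
noncomputable def lengthStats (n : ℕ) (π : Equiv.Perm ℤ) :
    ℤ × Set ℤ × Set ℤ × Set ℤ × Set (ℤ × ℤ) :=
  (invD n π, RmilPlus n π, RmilMinus n π, Lmil n π, lrMaxPairs n π)

noncomputable def sortingStats (n : ℕ) (π : Equiv.Perm ℤ) :
    ℤ × Set ℤ × Set ℤ × Set ℤ × Set (ℤ × ℤ) :=
  (sorD n π, CycPlus n π, CycMinus n π, Lmic π, lrMaxPairs n π)

/-! ### Inserting the largest letter into a word -/

/-- The signed permutation that moves the letter `N` to position `k` and shifts
`k, …, N - 1` to the right. -/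
def shiftCycle (k N : ℤ) (h1 : 1 ≤ k) (h2 : k ≤ N) : Equiv.Perm ℤ where
  toFun x := if k < x ∧ x ≤ N then x - 1 else if -N ≤ x ∧ x < -k then x + 1
    else if x = k then N else if x = -k then -N else x
  invFun x := if k ≤ x ∧ x < N then x + 1 else if -N < x ∧ x ≤ -k then x - 1
    else if x = N then k else if x = -N then -k else x
  left_inv x := by grind
  right_inv x := by grind

theorem shiftCycle_apply {k N : ℤ} (h1 : 1 ≤ k) (h2 : k ≤ N) (x : ℤ) :
    shiftCycle k N h1 h2 x = if k < x ∧ x ≤ N then x - 1 else if -N ≤ x ∧ x < -k then x + 1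
      else if x = k then N else if x = -k then -N else x := rfl

theorem shiftCycle_mem {n : ℕ} {k : ℤ} (h1 : 1 ≤ k) (h2 : k ≤ (n : ℤ)) :
    shiftCycle k n h1 h2 ∈ evenSignedPerm n := by
  refine ⟨⟨fun x => ?_, fun x hx => ?_⟩, ?_⟩
  · simp only [shiftCycle_apply]; grind
  · simp only [shiftCycle_apply]; grind
  · have : (Finset.Icc (1 : ℤ) n).filter (fun x => shiftCycle k n h1 h2 x < 0) = ∅ := by
      ext x
      simp only [shiftCycle_apply]
      grind
    rw [negCount, this]
    simp

/-- `1`, or the element negating the letters `1` and `N`, according to the sign of `i`. -/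
def negTop (N i : ℤ) : Equiv.Perm ℤ := if i < 0 then tD (-N) N else 1

theorem negTop_apply {N i : ℤ} (hN : 2 ≤ N) (x : ℤ) :
    negTop N i x = if i < 0 ∧ (|x| = 1 ∨ |x| = N) then -x else x := by
  unfold negTop tD
  simp only [if_true]
  split_ifs <;> simp only [Equiv.Perm.mul_apply, Equiv.swap_apply_def, Equiv.Perm.one_apply] <;>
    grind

theorem negTop_mem {n : ℕ} (hn : 2 ≤ n) (i : ℤ) : negTop n i ∈ evenSignedPerm n := by
  unfold negTop
  split_ifs
  · exact tD_mem ⟨by simp only; omega, le_rfl, Or.inr rfl⟩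
  · exact one_mem _

theorem negTop_mul_self {n : ℕ} (hn : 2 ≤ n) (i : ℤ) : negTop n i * negTop n i = 1 := by
  unfold negTop
  split_ifs
  · exact tD_mul_self (n := n) ⟨by simp only; omega, le_rfl, Or.inr rfl⟩
  · exact mul_one _

theorem evenSignedPerm_le_succ (n : ℕ) : evenSignedPerm n ≤ evenSignedPerm (n + 1) := by
  intro π hπ
  obtain ⟨l, hl, -⟩ := existsUnique_isSorting n hπ
  exact IsSorting.mem ⟨fun p hp => (hl.1 p hp).mono, hl.2⟩

/-- The word of `π` arises from that of `σ` by inserting `n + 1` with the sign of `i` at position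
`|i|`, up to the sign of the letter `1`. -/
structure IsInsertion (n : ℕ) (i : ℤ) (σ π : Equiv.Perm ℤ) : Prop where
  one_le : 1 ≤ |i|
  le_top : |i| ≤ (n : ℤ) + 1
  apply_abs : π |i| = if i < 0 then -((n : ℤ) + 1) else (n : ℤ) + 1
  abs_of_lt : ∀ x : ℤ, 1 ≤ x → x < |i| → |π x| = |σ x|
  abs_of_ge : ∀ x : ℤ, |i| ≤ x → x ≤ n → |π (x + 1)| = |σ x|
  eq_of_lt : ∀ x : ℤ, 1 ≤ x → x < |i| → |σ x| ≠ 1 → π x = σ x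
  eq_of_ge : ∀ x : ℤ, |i| ≤ x → x ≤ n → |σ x| ≠ 1 → π (x + 1) = σ x
  abs_bound : ∀ x : ℤ, 1 ≤ x → x ≤ n → 1 ≤ |σ x| ∧ |σ x| ≤ n

/-- The right factor rearranges places, and the left factor changes signs of letters; the latter can
affect only `±1` and `±(n + 1)`. -/
theorem isInsertion_mul {n : ℕ} (hn : 1 ≤ n) {i : ℤ} (h1 : 1 ≤ |i|) (h2 : |i| ≤ (n : ℤ) + 1)
    {σ : Equiv.Perm ℤ} (hσ : σ ∈ evenSignedPerm n) :
    IsInsertion n i σ (negTop ((n : ℤ) + 1) i * σ * shiftCycle |i| ((n : ℤ) + 1) h1 h2) := by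
  have hb : ∀ x : ℤ, 1 ≤ x → x ≤ n → 1 ≤ |σ x| ∧ |σ x| ≤ n := fun x hx hx' =>
    Finset.mem_Icc.1 (abs_mem hσ.1 (Finset.mem_Icc.2 ⟨hx, hx'⟩))
  have hlt : ∀ x : ℤ, 1 ≤ x → x < |i| → shiftCycle |i| ((n : ℤ) + 1) h1 h2 x = x := by
    intro x _ _
    rw [shiftCycle_apply]; grind
  have hge : ∀ x : ℤ, |i| ≤ x → x ≤ n → shiftCycle |i| ((n : ℤ) + 1) h1 h2 (x + 1) = x := by
    intro x _ _
    rw [shiftCycle_apply]; grind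
  have hneg : ∀ x : ℤ, |negTop ((n : ℤ) + 1) i x| = |x| := by
    intro x
    rw [negTop_apply (by omega)]
    split_ifs <;> simp
  have hneg' : ∀ x : ℤ, |x| ≠ 1 → |x| ≤ n → negTop ((n : ℤ) + 1) i x = x := by
    intro x _ _
    rw [negTop_apply (by omega), if_neg]
    omega
  refine ⟨h1, h2, ?_, ?_, ?_, ?_, ?_, hb⟩
  · have : shiftCycle |i| ((n : ℤ) + 1) h1 h2 |i| = (n : ℤ) + 1 := by
      rw [shiftCycle_apply]; grind
    rw [Equiv.Perm.mul_apply, Equiv.Perm.mul_apply, this, apply_top hσ, negTop_apply (by omega)]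
    grind
  · intro x hx hx'
    rw [Equiv.Perm.mul_apply, Equiv.Perm.mul_apply, hlt x hx hx', hneg]
  · intro x hx hx'
    rw [Equiv.Perm.mul_apply, Equiv.Perm.mul_apply, hge x hx hx', hneg]
  · intro x hx hx' hx1
    rw [Equiv.Perm.mul_apply, Equiv.Perm.mul_apply, hlt x hx hx',
      hneg' _ hx1 (hb x hx (by omega)).2]
  · intro x hx hx' hx1
    rw [Equiv.Perm.mul_apply, Equiv.Perm.mul_apply, hge x hx hx',
      hneg' _ hx1 (hb x (by omega) hx').2]

namespace IsInsertion

variable {n : ℕ} {i : ℤ} {σ π : Equiv.Perm ℤ}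

theorem abs_apply_abs (h : IsInsertion n i σ π) : |π (|i|)| = (n : ℤ) + 1 := by
  rw [h.apply_abs]
  split_ifs
  · rw [abs_neg, abs_of_pos (by omega)]
  · rw [abs_of_pos (by omega)]

/-- A letter exceeding all others neither creates nor destroys another right-to-left minimum, and is
one itself only in the last place. The letter `1` is excluded because its color may have changed. -/
theorem mem_Rmil_iff (h : IsInsertion n i σ π) (t : ZMod 2) {a : ℤ} (ha : a ≠ 1) :
    a ∈ Rmil (n + 1) t π ↔
      a ∈ Rmil n t σ ∨ (a = (n : ℤ) + 1 ∧ |i| = (n : ℤ) + 1 ∧ color π |i| = t) := by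
  have hk := h.abs_apply_abs
  have h1 := h.one_le
  have h2 := h.le_top
  simp only [Rmil, Set.mem_ofPred_eq, Nat.cast_add, Nat.cast_one]
  constructor
  · rintro ⟨x, hx1, hx2, hx3, hx4, rfl⟩
    rcases lt_trichotomy x |i| with hx | rfl | hx
    · left
      have e := h.abs_of_lt x hx1 hx
      refine ⟨x, hx1, by omega, fun y hy hy' => ?_, ?_, e.symm⟩
      · rcases lt_or_ge y |i| with hyk | hyk
        · rw [← e, ← h.abs_of_lt y (by omega) hyk]
          exact hx3 y hy (by omega)
        · rw [← e, ← h.abs_of_ge y hyk hy']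
          exact hx3 (y + 1) (by omega) (by omega)
      · rw [← hx4, color, color, h.eq_of_lt x hx1 hx (by omega)]
    · right
      refine ⟨hk, ?_, hx4⟩
      by_contra hne
      have h3 := hx3 ((n : ℤ) + 1) (by omega) le_rfl
      rw [h.abs_of_ge n (by omega) le_rfl] at h3
      have := (h.abs_bound n (by omega) le_rfl).2
      omega
    · left
      obtain ⟨x, rfl⟩ : ∃ z, x = z + 1 := ⟨x - 1, by ring⟩
      have e := h.abs_of_ge x (by omega) (by omega)
      refine ⟨x, by omega, by omega, fun y hy hy' => ?_, ?_, e.symm⟩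
      · rw [← e, ← h.abs_of_ge y (by omega) hy']
        exact hx3 (y + 1) (by omega) (by omega)
      · rw [← hx4, color, color, h.eq_of_ge x (by omega) (by omega) (by omega)]
  · rintro (⟨x, hx1, hx2, hx3, hx4, rfl⟩ | ⟨rfl, h3, h4⟩)
    · rcases lt_or_ge x |i| with hx | hx
      · have e := h.abs_of_lt x hx1 hx
        refine ⟨x, hx1, by omega, fun y hy hy' => ?_, ?_, e⟩
        · rcases lt_trichotomy y |i| with hyk | rfl | hyk
          · rw [e, h.abs_of_lt y (by omega) hyk]
            exact hx3 y hy (by omega)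
          · rw [e, hk]
            have := (h.abs_bound x hx1 hx2).2
            omega
          · obtain ⟨y, rfl⟩ : ∃ z, y = z + 1 := ⟨y - 1, by ring⟩
            rw [e, h.abs_of_ge y (by omega) (by omega)]
            exact hx3 y (by omega) (by omega)
        · rw [← hx4, color, color, h.eq_of_lt x hx1 hx (by omega)]
      · have e := h.abs_of_ge x hx hx2
        refine ⟨x + 1, by omega, by omega, fun y hy hy' => ?_, ?_, e⟩
        · obtain ⟨y, rfl⟩ : ∃ z, y = z + 1 := ⟨y - 1, by ring⟩
          rw [e, h.abs_of_ge y (by omega) (by omega)]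
          exact hx3 y (by omega) (by omega)
        · rw [← hx4, color, color, h.eq_of_ge x (by omega) (by omega) (by omega)]
    · exact ⟨|i|, h1, h2, fun y hy hy' => by omega, h4, hk⟩

theorem color_abs (h : IsInsertion n i σ π) : color π |i| = if i < 0 then 1 else 0 := by
  rw [color, h.apply_abs]
  split_ifs <;> first | rfl | omega

theorem RmilPlus_eq (h : IsInsertion n i σ π) :
    RmilPlus (n + 1) π = RmilPlus n σ ∪ {a | a = (n : ℤ) + 1 ∧ i = (n : ℤ) + 1} := by
  ext a
  by_cases ha : a = 1
  · simp [RmilPlus, ha]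
  · simp only [RmilPlus, Set.mem_union, Set.mem_singleton_iff, ha, or_false, Set.mem_ofPred_eq,
      h.mem_Rmil_iff 0 ha, h.color_abs]
    have : (|i| = (n : ℤ) + 1 ∧ (if i < 0 then (1 : ZMod 2) else 0) = 0) ↔ i = (n : ℤ) + 1 := by
      split_ifs with hi
      · simp; omega
      · rw [abs_of_nonneg (by omega)]; simp
    rw [this]

theorem RmilMinus_eq (h : IsInsertion n i σ π) (hn : 1 ≤ n) :
    RmilMinus (n + 1) π = RmilMinus n σ ∪ {a | a = (n : ℤ) + 1 ∧ i = -((n : ℤ) + 1)} := by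
  ext a
  by_cases ha : a = 1
  · simp [RmilMinus, ha]; omega
  · simp only [RmilMinus, Set.mem_union, Set.mem_sdiff, Set.mem_singleton_iff, ha, not_false_eq_true,
      and_true, Set.mem_ofPred_eq, h.mem_Rmil_iff 1 ha, h.color_abs]
    have : (|i| = (n : ℤ) + 1 ∧ (if i < 0 then (1 : ZMod 2) else 0) = 1) ↔
        i = -((n : ℤ) + 1) := by
      split_ifs with hi
      · rw [abs_of_neg hi]; simp; omega
      · simp; omega
    rw [this]

/-- The mirror image of `mem_Rmil_iff`: the largest letter is a left-to-right minimum only in the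
first place. Colors play no role, so `1` needs no exception. -/
theorem Lmil_eq (h : IsInsertion n i σ π) :
    Lmil (n + 1) π = Lmil n σ ∪ {a | a = (n : ℤ) + 1 ∧ |i| = 1} := by
  have hk := h.abs_apply_abs
  have h1 := h.one_le
  have h2 := h.le_top
  ext a
  simp only [Lmil, Set.mem_union, Set.mem_ofPred_eq, Nat.cast_add, Nat.cast_one]
  constructor
  · rintro ⟨x, hx1, hx2, hx3, rfl⟩
    rcases lt_trichotomy x |i| with hx | rfl | hx
    · left
      have e := h.abs_of_lt x hx1 hx
      refine ⟨x, hx1, by omega, fun y hy hy' => ?_, e.symm⟩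
      rw [← e, ← h.abs_of_lt y hy (by omega)]
      exact hx3 y hy hy'
    · right
      refine ⟨hk, ?_⟩
      by_contra hne
      have h3 := hx3 1 le_rfl (by omega)
      rw [h.abs_of_lt 1 le_rfl (by omega)] at h3
      have := (h.abs_bound 1 le_rfl (by omega)).2
      omega
    · left
      obtain ⟨x, rfl⟩ : ∃ z, x = z + 1 := ⟨x - 1, by ring⟩
      have e := h.abs_of_ge x (by omega) (by omega)
      refine ⟨x, by omega, by omega, fun y hy hy' => ?_, e.symm⟩
      rcases lt_or_ge y |i| with hyk | hyk
      · rw [← e, ← h.abs_of_lt y hy hyk]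
        exact hx3 y hy (by omega)
      · rw [← e, ← h.abs_of_ge y hyk (by omega)]
        exact hx3 (y + 1) (by omega) (by omega)
  · rintro (⟨x, hx1, hx2, hx3, rfl⟩ | ⟨rfl, h3⟩)
    · rcases lt_or_ge x |i| with hx | hx
      · have e := h.abs_of_lt x hx1 hx
        refine ⟨x, hx1, by omega, fun y hy hy' => ?_, e⟩
        rw [e, h.abs_of_lt y hy (by omega)]
        exact hx3 y hy hy'
      · have e := h.abs_of_ge x hx hx2
        refine ⟨x + 1, by omega, by omega, fun y hy hy' => ?_, e⟩
        rcases lt_trichotomy y |i| with hyk | rfl | hyk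
        · rw [e, h.abs_of_lt y hy hyk]
          exact hx3 y hy (by omega)
        · rw [e, hk]
          have := (h.abs_bound x hx1 hx2).2
          omega
        · obtain ⟨y, rfl⟩ : ∃ z, y = z + 1 := ⟨y - 1, by ring⟩
          rw [e, h.abs_of_ge y (by omega) (by omega)]
          exact hx3 y (by omega) (by omega)
    · exact ⟨|i|, h1, h2, fun y hy hy' => by omega, hk⟩

end IsInsertion

/-- The recursion for left-to-right maxima only depends on the letters up to the place of the
largest letter. -/
theorem lrMaxPairs_succ {n : ℕ} {k : ℤ} {σ π : Equiv.Perm ℤ} (h1 : 1 ≤ k) (h2 : k ≤ (n : ℤ) + 1)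
    (hk : |π k| = (n : ℤ) + 1) (hlt : ∀ x : ℤ, 1 ≤ x → x < k → |π x| = |σ x|)
    (hle : ∀ x : ℤ, 1 ≤ x → x ≤ (n : ℤ) + 1 → |π x| ≤ (n : ℤ) + 1)
    (hσ : ∀ x : ℤ, 1 ≤ x → x ≤ n → |σ x| ≤ n) :
    lrMaxPairs (n + 1) π = {p | p ∈ lrMaxPairs n σ ∧ p.1 < k} ∪ {(k, (n : ℤ) + 1)} := by
  ext ⟨x, a⟩
  simp only [lrMaxPairs, Set.mem_union, Set.mem_ofPred_eq, Set.mem_singleton_iff, Prod.mk.injEq,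
    Nat.cast_add, Nat.cast_one]
  constructor
  · rintro ⟨hx1, hx2, hx3, rfl⟩
    rcases lt_trichotomy x k with hx | rfl | hx
    · left
      refine ⟨⟨hx1, by omega, fun y hy hy' => ?_, (hlt x hx1 hx).symm⟩, hx⟩
      rw [← hlt x hx1 hx, ← hlt y hy (by omega)]
      exact hx3 y hy hy'
    · exact Or.inr ⟨rfl, hk⟩
    · have := hx3 k h1 hx
      have := hle x hx1 hx2
      omega
  · rintro (⟨⟨hx1, hx2, hx3, rfl⟩, hx⟩ | ⟨rfl, rfl⟩)
    · refine ⟨hx1, by omega, fun y hy hy' => ?_, hlt x hx1 hx⟩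
      rw [hlt x hx1 hx, hlt y hy (by omega)]
      exact hx3 y hy hy'
    · refine ⟨h1, h2, fun y hy hy' => ?_, hk⟩
      rw [hk, hlt y hy hy']
      have := hσ y hy (by omega)
      omega

theorem sum_Icc_succ {M : Type*} [AddCommMonoid M] (n : ℕ) (g : ℤ → M) :
    ∑ x ∈ Finset.Icc (1 : ℤ) ((n : ℤ) + 1), g x
      = ∑ x ∈ Finset.Icc (1 : ℤ) n, g x + g ((n : ℤ) + 1) := by
  have : Finset.Icc (1 : ℤ) ((n : ℤ) + 1) = insert ((n : ℤ) + 1) (Finset.Icc (1 : ℤ) n) := by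
    ext x; simp only [Finset.mem_Icc, Finset.mem_insert]; omega
  rw [this, Finset.sum_insert (by simp), add_comm]

/-- Splitting a sum over `1, …, n + 1` at position `k`. -/
theorem sum_Icc_succ_insert (n : ℕ) {k : ℤ} (h1 : 1 ≤ k) (h2 : k ≤ (n : ℤ) + 1) (g : ℤ → ℤ) :
    ∑ x ∈ Finset.Icc (1 : ℤ) ((n : ℤ) + 1), g x
      = ∑ x ∈ Finset.Icc (1 : ℤ) n, g (if x < k then x else x + 1) + g k := by
  have e := sum_Icc_succ n (fun x => g ((shiftCycle k ((n : ℤ) + 1) h1 h2)⁻¹ x))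
  have e' : ∀ x, (shiftCycle k ((n : ℤ) + 1) h1 h2)⁻¹ x = if k ≤ x ∧ x < (n : ℤ) + 1 then x + 1
    else if -((n : ℤ) + 1) < x ∧ x ≤ -k then x - 1
    else if x = (n : ℤ) + 1 then k else if x = -((n : ℤ) + 1) then -k else x := fun x => rfl
  have hs : ∑ x ∈ Finset.Icc (1 : ℤ) ((n : ℤ) + 1), g x =
      ∑ x ∈ Finset.Icc (1 : ℤ) ((n : ℤ) + 1), g ((shiftCycle k ((n : ℤ) + 1) h1 h2)⁻¹ x) := by
    symm
    refine Finset.sum_equiv (shiftCycle k ((n : ℤ) + 1) h1 h2)⁻¹ (fun x => ?_) (fun _ _ => rfl)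
    rw [e']
    simp only [Finset.mem_Icc]
    grind
  rw [hs, e]
  congr 1
  · refine Finset.sum_congr rfl fun x hx => ?_
    rw [Finset.mem_Icc] at hx
    rw [e']
    congr 1
    grind
  · rw [e']
    congr 1
    grind

/-- Each of the `n + 1 - |i|` letters after the new one adds 1; each of the `|i| - 1` letters before
it adds 2 if the new letter is negative and 0 otherwise. Old pairs keep their weight. -/
theorem IsInsertion.invD_eq {n : ℕ} {i : ℤ} {σ π : Equiv.Perm ℤ} (h : IsInsertion n i σ π)
    (hσ : σ ∈ evenSignedPerm n) :
    invD (n + 1) π = invD n σ + ((n : ℤ) + 1 - i - 2 * (if i < 0 then 1 else 0)) := by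
  have h1 := h.one_le
  have h2 := h.le_top
  have hk := h.abs_apply_abs
  have hu : ∀ x ∈ Finset.Icc (1 : ℤ) n, |π (if x < |i| then x else x + 1)| = |σ x| ∧
      (|σ x| ≠ 1 → π (if x < |i| then x else x + 1) = σ x) := by
    intro x hx
    rw [Finset.mem_Icc] at hx
    split_ifs with hc
    · exact ⟨h.abs_of_lt x hx.1 hc, h.eq_of_lt x hx.1 hc⟩
    · exact ⟨h.abs_of_ge x (by omega) hx.2, h.eq_of_ge x (by omega) hx.2⟩
  have hinj : ∀ x ∈ Finset.Icc (1 : ℤ) n, ∀ y ∈ Finset.Icc (1 : ℤ) n, x < y → |σ x| ≠ |σ y| := by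
    intro x hx y hy hxy he
    rw [Finset.mem_Icc] at hx hy
    rcases abs_eq_abs.1 he with he | he
    · have := σ.injective he
      omega
    · exact apply_ne_neg_apply hσ.1 (by omega) he
  have hone : ∀ x ∈ Finset.Icc (1 : ℤ) n, 1 ≤ |σ x| ∧ |σ x| ≤ n := fun x hx =>
    h.abs_bound x (Finset.mem_Icc.1 hx).1 (Finset.mem_Icc.1 hx).2
  have hrow : ∀ x ∈ Finset.Icc (1 : ℤ) n, ∑ y ∈ Finset.Icc (1 : ℤ) ((n : ℤ) + 1),
      (if (if x < |i| then x else x + 1) < y then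
        pairWeight (π (if x < |i| then x else x + 1)) (π y) else 0) =
      (∑ y ∈ Finset.Icc (1 : ℤ) n, if x < y then pairWeight (σ x) (σ y) else 0) +
        if x < |i| then (if i < 0 then 2 else 0) else 0 := by
    intro x hx
    obtain ⟨hx1, hx2⟩ := hu x hx
    have hbx := hone x hx
    rw [sum_Icc_succ_insert n h1 h2]
    congr 1
    · refine Finset.sum_congr rfl fun y hy => ?_
      obtain ⟨hy1, hy2⟩ := hu y hy
      have e : ((if x < |i| then x else x + 1) < if y < |i| then y else y + 1) ↔ x < y := by
        split_ifs <;> omega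
      simp only [e]
      by_cases hxy : x < y
      · rw [if_pos hxy, if_pos hxy]
        have hne := hinj x hx y hy hxy
        rw [pairWeight_eq hne, pairWeight_eq (by rwa [hx1, hy1]), hx1, hy1]
        congr 1
        -- The sign of the later letter counts only in the first case, where that letter exceeds
        -- another in absolute value and so is not `±1`.
        by_cases hlt : |σ x| < |σ y|
        · rw [hy2 (by omega)]
        · rw [if_neg (fun hc => hlt hc.2), if_neg (fun hc => hlt hc.2)]
      · rw [if_neg hxy, if_neg hxy]
    · by_cases hxk : x < |i|
      · rw [if_pos hxk] at hx1
        simp only [if_pos hxk]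
        rw [pairWeight_eq (by rw [hx1, hk]; omega), hx1, hk, if_neg (by omega), h.apply_abs]
        split_ifs <;> omega
      · simp only [if_neg hxk]
        rw [if_neg (by omega)]
  have hlast : ∑ y ∈ Finset.Icc (1 : ℤ) ((n : ℤ) + 1),
      (if |i| < y then pairWeight (π |i|) (π y) else 0) =
      ∑ y ∈ Finset.Icc (1 : ℤ) n, if |i| ≤ y then 1 else 0 := by
    rw [sum_Icc_succ_insert n h1 h2, if_neg (lt_irrefl _), add_zero]
    refine Finset.sum_congr rfl fun y hy => ?_
    obtain ⟨hy1, -⟩ := hu y hy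
    have hby := hone y hy
    by_cases hyk : y < |i|
    · simp only [if_pos hyk]
      rw [if_neg (by omega), if_neg (by omega)]
    · rw [if_neg hyk] at hy1
      simp only [if_neg hyk]
      rw [if_pos (by omega), if_pos (by omega), pairWeight_eq (by rw [hy1, hk]; omega), hy1, hk,
        if_pos (by omega), if_neg (by omega), add_zero]
  have hcount : ∑ y ∈ Finset.Icc (1 : ℤ) n, (if |i| ≤ y then (1 : ℤ) else 0) =
      (n : ℤ) + 1 - |i| := by
    rw [← Finset.sum_filter]
    have : (Finset.Icc (1 : ℤ) n).filter (fun y => |i| ≤ y) = Finset.Icc |i| n := by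
      ext y; simp only [Finset.mem_filter, Finset.mem_Icc]; omega
    rw [this, Finset.sum_const, Int.card_Icc, nsmul_eq_mul, mul_one]
    omega
  have hcount' (c : ℤ) : ∑ y ∈ Finset.Icc (1 : ℤ) n, (if y < |i| then c else 0) =
      (|i| - 1) * c := by
    rw [← Finset.sum_filter]
    have : (Finset.Icc (1 : ℤ) n).filter (fun y => y < |i|) = Finset.Icc 1 (|i| - 1) := by
      ext y; simp only [Finset.mem_filter, Finset.mem_Icc]; omega
    rw [this, Finset.sum_const, Int.card_Icc, nsmul_eq_mul]
    congr 1
    omega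
  unfold invD
  push_cast
  rw [sum_Icc_succ_insert n h1 h2, Finset.sum_congr rfl hrow, Finset.sum_add_distrib, hlast,
    hcount, hcount']
  split_ifs with hi
  · rw [abs_of_neg hi]; ring
  · rw [abs_of_nonneg (by omega)]; ring

theorem lengthStats_insert {n : ℕ} (hn : 1 ≤ n) {i : ℤ} {σ π : Equiv.Perm ℤ}
    (h : IsInsertion n i σ π) (hσ : σ ∈ evenSignedPerm n) (hπ : π ∈ evenSignedPerm (n + 1)) :
    lengthStats (n + 1) π = addTop ((n : ℤ) + 1) i (lengthStats n σ) := by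
  unfold lengthStats addTop
  rw [h.invD_eq hσ, h.RmilPlus_eq, h.RmilMinus_eq hn, h.Lmil_eq,
    lrMaxPairs_succ h.one_le h.le_top h.abs_apply_abs h.abs_of_lt
      (fun x hx hx' => ?_) (fun x hx hx' => (h.abs_bound x hx hx').2)]
  have := Finset.mem_Icc.1 (abs_mem hπ.1 (i := x) (by simp; omega))
  exact_mod_cast this.2

/-! ### The sorting index under right multiplication by `t^D` -/

theorem sorD_eq_sum {n : ℕ} {π : Equiv.Perm ℤ} {l : List (ℤ × ℤ)} (h : IsSorting n π l) :
    sorD n π = (l.map (fun p => p.2 - p.1 - 2 * (if p.1 < 0 then 1 else 0))).sum := by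
  have hex : ∃ l, IsSorting n π l := ⟨l, h⟩
  have he : hex.choose = l := (existsUnique_isSorting n h.mem).unique hex.choose_spec h
  rw [sorD, dif_pos hex, he]

theorem isIndex_top {n : ℕ} (hn : 1 ≤ n) {i : ℤ} (h1 : 1 ≤ |i|) (h2 : |i| ≤ (n : ℤ) + 1)
    (hi : i ≠ (n : ℤ) + 1) : IsIndex (n + 1) (i, (n : ℤ) + 1) := by
  refine ⟨by simp only; omega, by simp, ?_⟩
  simp only
  grind

theorem tD_self {N : ℤ} (hN : 1 ≤ N) : tD N N = 1 := by
  unfold tD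
  rw [if_neg (by omega), Equiv.swap_self, Equiv.swap_self]
  rfl

/-- The new element is appended to the factorization of `σ` as its last factor. For `i = n + 1` it
is the identity, no factor is added, and the increment is 0. -/
theorem sorD_mul_tD {n : ℕ} (hn : 1 ≤ n) {i : ℤ} (h1 : 1 ≤ |i|) (h2 : |i| ≤ (n : ℤ) + 1)
    {σ : Equiv.Perm ℤ} (hσ : σ ∈ evenSignedPerm n) :
    sorD (n + 1) (σ * tD i ((n : ℤ) + 1)) =
      sorD n σ + ((n : ℤ) + 1 - i - 2 * (if i < 0 then 1 else 0)) := by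
  obtain ⟨l, hl, -⟩ := existsUnique_isSorting n hσ
  rw [sorD_eq_sum hl]
  by_cases hi : i = (n : ℤ) + 1
  · rw [hi, tD_self (by omega), mul_one,
      sorD_eq_sum (n := n + 1) ⟨fun p hp => (hl.1 p hp).mono, hl.2⟩, if_neg (by omega)]
    ring
  · have hidx := isIndex_top hn h1 h2 hi
    rw [sorD_eq_sum (isSorting_concat (l := l) hidx (by rwa [mul_assoc, tD_mul_self hidx, mul_one]))]
    simp

/-! ### Inserting the largest letter into a cycle -/

/-- `|π|` arises from `|σ|` by inserting `n + 1` in a cycle after `|i|`, or as a new cycle if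
`|i| = n + 1`; colors of cycles are kept, except possibly for the cycle of `1`. -/
structure IsCycleInsertion (n : ℕ) (i : ℤ) (σ π : Equiv.Perm ℤ) : Prop where
  one_le : 1 ≤ |i|
  le_top : |i| ≤ (n : ℤ) + 1
  abs_apply_abs : |π (|i|)| = (n : ℤ) + 1
  abs_of_ne : ∀ x : ℤ, 1 ≤ x → x ≤ n → x ≠ |i| → |π x| = |σ x|
  abs_apply_top : |i| ≤ n → |π ((n : ℤ) + 1)| = |σ (|i|)|
  color_of_ne : ∀ x : ℤ, 1 ≤ x → x ≤ n → x ≠ |i| → x ≠ 1 ∨ |i| ≤ n → color π x = color σ x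
  color_add : |i| ≤ n → color π |i| + color π ((n : ℤ) + 1) = color σ |i|
  color_top : |i| = (n : ℤ) + 1 → color π ((n : ℤ) + 1) = if i < 0 then 1 else 0
  abs_bound : ∀ x : ℤ, 1 ≤ x → x ≤ n → 1 ≤ |σ x| ∧ |σ x| ≤ n

theorem color_neg_add_one {n : ℕ} {σ : Equiv.Perm ℤ} (hσ : σ ∈ signedPerm n) {x : ℤ}
    (hx : x ≠ 0) : 1 + color σ (-x) = color σ x := by
  have h0 : σ x ≠ 0 := fun h' => hx (σ.injective (h'.trans (apply_zero hσ).symm))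
  unfold color
  rw [hσ.1]
  rcases lt_or_gt_of_ne h0 with h | h
  · rw [if_neg (by omega), if_pos h, add_zero]
  · rw [if_pos (by omega), if_neg (by omega)]
    decide

theorem isCycleInsertion_mul_tD {n : ℕ} (hn : 1 ≤ n) {i : ℤ} (h1 : 1 ≤ |i|)
    (h2 : |i| ≤ (n : ℤ) + 1) {σ : Equiv.Perm ℤ} (hσ : σ ∈ evenSignedPerm n) :
    IsCycleInsertion n i σ (σ * tD i ((n : ℤ) + 1)) := by
  have hb : ∀ x : ℤ, 1 ≤ x → x ≤ n → 1 ≤ |σ x| ∧ |σ x| ≤ n := fun x hx hx' =>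
    Finset.mem_Icc.1 (abs_mem hσ.1 (Finset.mem_Icc.2 ⟨hx, hx'⟩))
  have htop := apply_top hσ
  have hntop : σ (-((n : ℤ) + 1)) = -((n : ℤ) + 1) := by rw [hσ.1.1, htop]
  -- The last exceptional branch reflects the special form of `t^D` for `i = -(n + 1)`, which also
  -- negates `1`. If `|i| = n + 1`, the place `n + 1` already falls under the first branch.
  have ht : ∀ x : ℤ, 1 ≤ x → x ≤ (n : ℤ) + 1 → tD i ((n : ℤ) + 1) x =
      if x = |i| then (if i < 0 then -((n : ℤ) + 1) else (n : ℤ) + 1)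
      else if x = (n : ℤ) + 1 then i
      else if x = 1 ∧ i = -((n : ℤ) + 1) then -1 else x := by
    intro x hx hx'
    unfold tD
    split_ifs <;> simp only [Equiv.Perm.mul_apply, Equiv.swap_apply_def] <;> grind
  refine ⟨h1, h2, ?_, ?_, ?_, ?_, ?_, ?_, hb⟩
  · rw [Equiv.Perm.mul_apply, ht _ h1 h2, if_pos rfl]
    split_ifs
    · rw [hntop, abs_neg, abs_of_pos (by omega)]
    · rw [htop, abs_of_pos (by omega)]
  · intro x hx hx' hxi
    rw [Equiv.Perm.mul_apply, ht x hx (by omega), if_neg hxi, if_neg (by omega)]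
    split_ifs with hc
    · rw [hσ.1.1, abs_neg, hc.1]
    · rfl
  · intro hi
    rw [Equiv.Perm.mul_apply, ht _ (by omega) le_rfl, if_neg (by omega), if_pos rfl]
    rcases abs_choice i with h | h <;> rw [h]
    rw [hσ.1.1, abs_neg]
  · intro x hx hx' hxi hc
    have e : tD i ((n : ℤ) + 1) x = x := by
      rw [ht x hx (by omega), if_neg hxi, if_neg (by omega), if_neg]
      rintro ⟨hc1, rfl⟩
      rw [abs_neg, abs_of_pos (by omega)] at hc
      omega
    rw [color, color, Equiv.Perm.mul_apply, e]
  · intro hi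
    have e1 : color (σ * tD i ((n : ℤ) + 1)) |i| = if i < 0 then 1 else 0 := by
      rw [color, Equiv.Perm.mul_apply, ht _ h1 h2, if_pos rfl]
      split_ifs with hc hd hd
      · rfl
      · rw [hntop] at hd; omega
      · rw [htop] at hd; omega
      · rfl
    have e2 : color (σ * tD i ((n : ℤ) + 1)) ((n : ℤ) + 1) = color σ i := by
      have e : tD i ((n : ℤ) + 1) ((n : ℤ) + 1) = i := by
        rw [ht _ (by omega) le_rfl, if_neg (by omega), if_pos rfl]
      rw [color, color, Equiv.Perm.mul_apply, e]
    rw [e1, e2]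
    split_ifs with hc
    · rw [abs_of_neg hc, ← color_neg_add_one hσ.1 (x := -i) (by omega), neg_neg]
    · rw [abs_of_nonneg (by omega), zero_add]
  · intro hi
    rw [color, Equiv.Perm.mul_apply, ht _ (by omega) le_rfl, if_pos hi.symm]
    split_ifs with hc hd hd
    · rfl
    · rw [hntop] at hd; omega
    · rw [htop] at hd; omega
    · rfl

theorem self_mem_absCycle (π : Equiv.Perm ℤ) (a : ℤ) : a ∈ absCycle π a := ⟨0, rfl⟩

theorem absCycle_succ {π : Equiv.Perm ℤ} {a b : ℤ} (h : b ∈ absCycle π a) :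
    |π b| ∈ absCycle π a := by
  obtain ⟨k, rfl⟩ := h
  exact ⟨k + 1, by rw [Function.iterate_succ_apply']⟩

theorem absCycle_subset {π : Equiv.Perm ℤ} {a : ℤ} {S : Set ℤ} (ha : a ∈ S)
    (hS : ∀ b ∈ S, |π b| ∈ S) : absCycle π a ⊆ S := by
  rintro _ ⟨k, rfl⟩
  induction k with
  | zero => exact ha
  | succ k ih => rw [Function.iterate_succ_apply']; exact hS _ ih

/-- The orbit of `y` under `F` meets `a` before any other number `≤ a`. -/
inductive HitsFirst (F : ℤ → ℤ) (a : ℤ) : ℤ → Prop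
  | here : HitsFirst F a a
  | step (y : ℤ) : a < y → HitsFirst F a (F y) → HitsFirst F a y

theorem HitsFirst.le {F : ℤ → ℤ} {a y : ℤ} (h : HitsFirst F a y) : a ≤ y := by
  cases h with
  | here => exact le_rfl
  | step _ h1 _ => exact h1.le

theorem hitsFirst_iff (F : ℤ → ℤ) (a y : ℤ) :
    HitsFirst F a y ↔ ∃ m : ℕ, (∀ r < m, F^[m] y < F^[r] y) ∧ F^[m] y = a := by
  constructor
  · intro h
    induction h with
    | here => exact ⟨0, by simp, rfl⟩
    | step y hy _ ih =>
      obtain ⟨m, hm, rfl⟩ := ih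
      refine ⟨m + 1, fun r hr => ?_, rfl⟩
      cases r with
      | zero => exact hy
      | succ r => exact hm r (by omega)
  · rintro ⟨m, hm, rfl⟩
    induction m generalizing y with
    | zero => exact .here
    | succ m ih => exact .step y (hm 0 (by omega)) (ih (F y) fun r hr => hm (r + 1) (by omega))

theorem abs_pow_apply {n : ℕ} {π : Equiv.Perm ℤ} (hπ : π ∈ signedPerm n) (m : ℕ) (x : ℤ) :
    |(π ^ (m + 1)) x| = (fun y => |π y|)^[m] |π x| := by
  induction m with
  | zero => simp
  | succ m ih =>
    rw [Function.iterate_succ_apply', ← ih, pow_succ' π (m + 1), Equiv.Perm.mul_apply]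
    rcases abs_choice ((π ^ (m + 1)) x) with h | h <;> rw [h]
    rw [hπ.1, abs_neg]

/-- The word starts with `|π 1|`, so its `k`-th letter is the iterate of order `k - 1` from there.
-/
theorem mem_Lmic_iff {n : ℕ} {π : Equiv.Perm ℤ} (hπ : π ∈ signedPerm n) (a : ℤ) :
    a ∈ Lmic π ↔ HitsFirst (fun y => |π y|) a |π 1| := by
  rw [hitsFirst_iff]
  constructor
  · rintro ⟨k, hk, h, rfl⟩
    obtain ⟨m, rfl⟩ : ∃ m, k = m + 1 := ⟨k - 1, by omega⟩
    refine ⟨m, fun r hr => ?_, (abs_pow_apply hπ m 1).symm⟩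
    rw [← abs_pow_apply hπ, ← abs_pow_apply hπ]
    exact h (r + 1) (by omega) (by omega)
  · rintro ⟨m, h, rfl⟩
    refine ⟨m + 1, by omega, fun r hr hr' => ?_, abs_pow_apply hπ m 1⟩
    obtain ⟨r, rfl⟩ : ∃ s, r = s + 1 := ⟨r - 1, by omega⟩
    rw [abs_pow_apply hπ, abs_pow_apply hπ]
    exact h r (by omega)

namespace IsCycleInsertion

variable {n : ℕ} {i : ℤ} {σ π : Equiv.Perm ℤ}

theorem absCycle_subset_Icc (h : IsCycleInsertion n i σ π) {a : ℤ} (h1 : 1 ≤ a) (h2 : a ≤ n) :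
    absCycle σ a ⊆ Set.Icc 1 (n : ℤ) :=
  absCycle_subset ⟨h1, h2⟩ fun b hb => h.abs_bound b hb.1 hb.2

/-- The step of `|σ|` out of `|i|` becomes two steps of `|π|`, passing through `n + 1`; all other
steps within `1, …, n` are unchanged. -/
theorem absCycle_eq (h : IsCycleInsertion n i σ π) {a : ℤ} (h1 : 1 ≤ a) (h2 : a ≤ n) :
    absCycle π a = absCycle σ a ∪ {b | b = (n : ℤ) + 1 ∧ |i| ∈ absCycle σ a} := by
  have hsub := h.absCycle_subset_Icc h1 h2
  apply subset_antisymm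
  · refine absCycle_subset (Or.inl (self_mem_absCycle σ a)) ?_
    rintro b (hb | ⟨rfl, hb⟩)
    · by_cases hbi : b = |i|
      · exact Or.inr ⟨by rw [hbi, h.abs_apply_abs], hbi ▸ hb⟩
      · left
        rw [h.abs_of_ne b (hsub hb).1 (hsub hb).2 hbi]
        exact absCycle_succ hb
    · left
      rw [h.abs_apply_top (hsub hb).2]
      exact absCycle_succ hb
  · have hl : absCycle σ a ⊆ absCycle π a := by
      have : absCycle σ a ⊆ {b | b ∈ absCycle π a ∧ b ∈ Set.Icc 1 (n : ℤ)} := by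
        refine absCycle_subset ⟨self_mem_absCycle π a, h1, h2⟩ ?_
        rintro b ⟨hb, hb1, hb2⟩
        refine ⟨?_, h.abs_bound b hb1 hb2⟩
        by_cases hbi : b = |i|
        · have e := absCycle_succ (absCycle_succ hb)
          rw [hbi, h.abs_apply_abs, h.abs_apply_top (by omega)] at e
          rwa [hbi]
        · rw [← h.abs_of_ne b hb1 hb2 hbi]
          exact absCycle_succ hb
      exact fun b hb => (this hb).1
    rintro b (hb | ⟨rfl, hb⟩)
    · exact hl hb
    · rw [← h.abs_apply_abs]
      exact absCycle_succ (hl hb)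

open Classical in
-- If the cycle contains `|i|`, the color of `|i|` is split between `|i|` and `n + 1`. Otherwise a
-- color could change only at place `1`, which a cycle with minimum at least 2 avoids.
theorem sum_color_absCycle (h : IsCycleInsertion n i σ π) {a : ℤ} (h1 : 2 ≤ a) (h2 : a ≤ n)
    (hmin : ∀ b ∈ absCycle σ a, a ≤ b) :
    ∑ x ∈ (Finset.Icc (1 : ℤ) ((n + 1 : ℕ) : ℤ)).filter (fun x => x ∈ absCycle π a), color π x =
      ∑ x ∈ (Finset.Icc (1 : ℤ) n).filter (fun x => x ∈ absCycle σ a), color σ x := by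
  have hsub := h.absCycle_subset_Icc (by omega) h2
  have hmem : ∀ x ∈ Finset.Icc (1 : ℤ) n, (x ∈ absCycle π a ↔ x ∈ absCycle σ a) := by
    intro x hx
    rw [Finset.mem_Icc] at hx
    rw [h.absCycle_eq (by omega) h2]
    simp only [Set.mem_union, Set.mem_ofPred_eq]
    exact or_iff_left (by omega)
  have htop : ((n : ℤ) + 1) ∈ absCycle π a ↔ |i| ∈ absCycle σ a := by
    rw [h.absCycle_eq (by omega) h2]
    constructor
    · rintro (hb | hb)
      · have := (hsub hb).2
        omega
      · exact hb.2
    · exact fun hb => Or.inr ⟨rfl, hb⟩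
  rw [Finset.sum_filter, Finset.sum_filter, Nat.cast_add, Nat.cast_one, sum_Icc_succ,
    Finset.sum_congr rfl (fun x hx => by rw [if_congr (hmem x hx) rfl rfl]), if_congr htop rfl rfl]
  by_cases hi : |i| ∈ absCycle σ a
  · have hin := (hsub hi).2
    have him : |i| ∈ Finset.Icc (1 : ℤ) n := Finset.mem_Icc.2 (hsub hi)
    rw [if_pos hi, ← Finset.add_sum_erase _ _ him, ← Finset.add_sum_erase _ _ him, if_pos hi,
      if_pos hi, ← h.color_add hin, add_right_comm]
    congr 1
    refine Finset.sum_congr rfl fun x hx => ?_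
    rw [Finset.mem_erase, Finset.mem_Icc] at hx
    rw [h.color_of_ne x hx.2.1 hx.2.2 hx.1 (Or.inr hin)]
  · rw [if_neg hi, add_zero]
    refine Finset.sum_congr rfl fun x hx => ?_
    rw [Finset.mem_Icc] at hx
    split_ifs with hxc
    · have := hmin x hxc
      exact h.color_of_ne x hx.1 hx.2 (fun e => hi (e ▸ hxc)) (Or.inl (by omega))
    · rfl

theorem mem_Cyc_iff (h : IsCycleInsertion n i σ π) (t : ZMod 2) {a : ℤ} (ha : a ≠ 1) :
    a ∈ Cyc (n + 1) t π ↔ a ∈ Cyc n t σ ∨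
      (a = (n : ℤ) + 1 ∧ |i| = (n : ℤ) + 1 ∧ color π ((n : ℤ) + 1) = t) := by
  classical
  by_cases ha1 : 1 ≤ a
  swap
  · have := h.one_le
    refine ⟨fun hc => absurd hc.1 ha1, ?_⟩
    rintro (hc | ⟨hc, -⟩)
    · exact absurd hc.1 ha1
    · omega
  by_cases han : a ≤ n
  · have hsub := h.absCycle_subset_Icc ha1 han
    have hmin : (∀ b ∈ absCycle π a, a ≤ b) ↔ ∀ b ∈ absCycle σ a, a ≤ b := by
      rw [h.absCycle_eq ha1 han]
      constructor
      · exact fun hb b hb' => hb b (Or.inl hb')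
      · rintro hb b (hb' | ⟨rfl, -⟩)
        · exact hb b hb'
        · omega
    rw [or_iff_left (by omega)]
    constructor
    · rintro ⟨-, -, h3, h4⟩
      have h3' := hmin.1 h3
      refine ⟨ha1, han, h3', ?_⟩
      rw [← h4]
      convert (h.sum_color_absCycle (by omega) han h3').symm
    · rintro ⟨-, -, h3, h4⟩
      refine ⟨ha1, by push_cast; omega, hmin.2 h3, ?_⟩
      rw [← h4]
      convert h.sum_color_absCycle (by omega) han h3
  · rw [or_iff_right (fun hc => han hc.2.1)]
    have key (hi : |i| = (n : ℤ) + 1) : absCycle π ((n : ℤ) + 1) = {(n : ℤ) + 1} := by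
      apply subset_antisymm
      · refine absCycle_subset rfl ?_
        rintro b rfl
        have := h.abs_apply_abs
        rwa [hi] at this
      · rintro b rfl
        exact self_mem_absCycle _ _
    have hfil (hi : |i| = (n : ℤ) + 1) : (Finset.Icc (1 : ℤ) ((n + 1 : ℕ) : ℤ)).filter
        (fun x => x ∈ absCycle π ((n : ℤ) + 1)) = {(n : ℤ) + 1} := by
      rw [key hi]
      ext x
      simp only [Finset.mem_filter, Finset.mem_Icc, Set.mem_singleton_iff, Finset.mem_singleton]
      push_cast
      omega
    constructor
    · rintro ⟨-, h2, h3, h4⟩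
      push_cast at h2
      obtain rfl : a = (n : ℤ) + 1 := by omega
      have hi : |i| = (n : ℤ) + 1 := by
        -- If `|i| ≤ n`, the successor of `n + 1` is smaller than it and lies in its cycle.
        by_contra hne
        have hin : |i| ≤ n := by have := h.le_top; omega
        have e := h3 _ (absCycle_succ (self_mem_absCycle π _))
        rw [h.abs_apply_top hin] at e
        have := (h.abs_bound _ h.one_le hin).2
        omega
      refine ⟨rfl, hi, ?_⟩
      rw [← h4, ← Finset.sum_singleton (color π) ((n : ℤ) + 1), ← hfil hi]
    · rintro ⟨rfl, hi, h4⟩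
      refine ⟨ha1, by simp, fun b hb => ?_, ?_⟩
      · rw [key hi] at hb
        exact (Set.mem_singleton_iff.1 hb).ge
      · rw [← h4, ← Finset.sum_singleton (color π) ((n : ℤ) + 1), ← hfil hi]

theorem CycPlus_eq (h : IsCycleInsertion n i σ π) :
    CycPlus (n + 1) π = CycPlus n σ ∪ {a | a = (n : ℤ) + 1 ∧ i = (n : ℤ) + 1} := by
  ext a
  by_cases ha : a = 1
  · simp [CycPlus, ha]
  · simp only [CycPlus, Set.mem_union, Set.mem_singleton_iff, ha, or_false, Set.mem_ofPred_eq,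
      h.mem_Cyc_iff 0 ha]
    have : (|i| = (n : ℤ) + 1 ∧ color π ((n : ℤ) + 1) = 0) ↔ i = (n : ℤ) + 1 := by
      constructor
      · rintro ⟨h1, h2⟩
        rw [h.color_top h1] at h2
        split_ifs at h2 with hi
        · simp at h2
        · rwa [abs_of_nonneg (by omega)] at h1
      · intro hi
        have h1 : |i| = (n : ℤ) + 1 := by rw [hi, abs_of_pos (by omega)]
        rw [h.color_top h1, if_neg (by omega)]
        exact ⟨h1, rfl⟩
    rw [this]

theorem CycMinus_eq (h : IsCycleInsertion n i σ π) (hn : 1 ≤ n) :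
    CycMinus (n + 1) π = CycMinus n σ ∪ {a | a = (n : ℤ) + 1 ∧ i = -((n : ℤ) + 1)} := by
  ext a
  by_cases ha : a = 1
  · simp [CycMinus, ha]; omega
  · simp only [CycMinus, Set.mem_union, Set.mem_sdiff, Set.mem_singleton_iff, ha,
      not_false_eq_true, and_true, Set.mem_ofPred_eq, h.mem_Cyc_iff 1 ha]
    have : (|i| = (n : ℤ) + 1 ∧ color π ((n : ℤ) + 1) = 1) ↔ i = -((n : ℤ) + 1) := by
      constructor
      · rintro ⟨h1, h2⟩
        rw [h.color_top h1] at h2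
        split_ifs at h2 with hi
        · rw [abs_of_neg hi] at h1
          omega
        · simp at h2
      · intro hi
        have h1 : |i| = (n : ℤ) + 1 := by rw [hi, abs_neg, abs_of_pos (by omega)]
        rw [h.color_top h1, if_pos (by omega)]
        exact ⟨h1, rfl⟩
    rw [this]

/-- A detour through `n + 1`, which exceeds `a`, does not affect which number `≤ a` is met first. -/
theorem hitsFirst_iff (h : IsCycleInsertion n i σ π) {a y : ℤ} (ha : a ≤ n) (hy1 : 1 ≤ y)
    (hyn : y ≤ n) : HitsFirst (fun x => |π x|) a y ↔ HitsFirst (fun x => |σ x|) a y := by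
  constructor
  · intro hh
    -- The orbit under `|π|` may stand at `n + 1`, outside the range of comparison; there the claim
    -- is made about the number that `|σ|` reaches from `|i|`.
    have : (y ≤ n → HitsFirst (fun x => |σ x|) a y) ∧
        (y = (n : ℤ) + 1 → |i| ≤ n → HitsFirst (fun x => |σ x|) a |σ (|i|)|) := by
      clear hyn
      induction hh with
      | here => exact ⟨fun _ => .here, fun e => by omega⟩
      | step y hay _ ih =>
        refine ⟨fun hyn => .step y hay ?_, fun e hi => ?_⟩
        · have hb := h.abs_bound y hy1 hyn
          by_cases hyi : y = |i|
          · have e : |π y| = (n : ℤ) + 1 := by rw [hyi, h.abs_apply_abs]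
            have := (ih (by omega)).2 e (by omega)
            rwa [← hyi] at this
          · have e := h.abs_of_ne y hy1 hyn hyi
            simp only [e] at ih
            exact (ih (by omega)).1 (by omega)
        · have hb := h.abs_bound _ h.one_le hi
          have e' := h.abs_apply_top hi
          rw [← e] at e'
          simp only [e'] at ih
          exact (ih (by omega)).1 (by omega)
    exact this.1 hyn
  · intro hh
    induction hh with
    | here => exact .here
    | step y hay _ ih =>
      have hb := h.abs_bound y hy1 hyn
      have ih' := ih hb.1 hb.2
      refine .step y hay ?_
      by_cases hyi : y = |i|
      · subst hyi
        simp only [h.abs_apply_abs]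
        refine .step _ (by omega) ?_
        simp only [h.abs_apply_top hyn]
        exact ih'
      · simp only [h.abs_of_ne y hy1 hyn hyi]
        exact ih'

/-- The new letter is a left-to-right minimum only if it opens the word, that is, if `|i| = 1`;
otherwise the opening letter is already smaller. -/
theorem Lmic_eq (h : IsCycleInsertion n i σ π) (hn : 1 ≤ n) (hσ : σ ∈ signedPerm n)
    (hπ : π ∈ signedPerm (n + 1)) :
    Lmic π = Lmic σ ∪ {a | a = (n : ℤ) + 1 ∧ |i| = 1} := by
  ext a
  simp only [Set.mem_union, Set.mem_ofPred_eq]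
  rw [mem_Lmic_iff hσ, mem_Lmic_iff hπ]
  have hb := h.abs_bound 1 le_rfl (by omega)
  have hle := fun hh : HitsFirst (fun x => |σ x|) a |σ 1| => hh.le.trans hb.2
  by_cases hi : |i| = 1
  · have e1 := h.abs_apply_abs
    have e2 := h.abs_apply_top (by omega)
    rw [hi] at e1 e2
    rw [e1]
    constructor
    · intro hh
      cases hh with
      | here => exact Or.inr ⟨rfl, hi⟩
      | step _ h1 h2 =>
        simp only [e2] at h2
        exact Or.inl ((h.hitsFirst_iff (by omega) hb.1 hb.2).1 h2)
    · rintro (hh | ⟨rfl, -⟩)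
      · have := hle hh
        refine .step _ (by omega) ?_
        simp only [e2]
        exact (h.hitsFirst_iff this hb.1 hb.2).2 hh
      · exact .here
  · rw [h.abs_of_ne 1 le_rfl (by omega) (Ne.symm hi), or_iff_left (fun hc => hi hc.2)]
    constructor
    · exact fun hh => (h.hitsFirst_iff (hh.le.trans hb.2) hb.1 hb.2).1 hh
    · exact fun hh => (h.hitsFirst_iff (hle hh) hb.1 hb.2).2 hh

end IsCycleInsertion

theorem sortingStats_mul_tD {n : ℕ} (hn : 1 ≤ n) {i : ℤ} (h1 : 1 ≤ |i|)
    (h2 : |i| ≤ (n : ℤ) + 1) {σ : Equiv.Perm ℤ} (hσ : σ ∈ evenSignedPerm n)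
    (hπ : σ * tD i ((n : ℤ) + 1) ∈ evenSignedPerm (n + 1)) :
    sortingStats (n + 1) (σ * tD i ((n : ℤ) + 1)) =
      addTop ((n : ℤ) + 1) i (sortingStats n σ) := by
  have h := isCycleInsertion_mul_tD hn h1 h2 hσ
  unfold sortingStats addTop
  rw [sorD_mul_tD hn h1 h2 hσ, h.CycPlus_eq, h.CycMinus_eq hn, h.Lmic_eq hn hσ.1 hπ.1,
    lrMaxPairs_succ h1 h2 h.abs_apply_abs
      (fun x hx hx' => h.abs_of_ne x hx (by omega) (by omega))
      (fun x hx hx' => ?_) (fun x hx hx' => (h.abs_bound x hx hx').2)]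
  have := Finset.mem_Icc.1 (abs_mem hπ.1 (i := x) (by simp; omega))
  exact_mod_cast this.2

/-! ### The bijection -/

theorem inv_apply_top_bounds {n : ℕ} {π : Equiv.Perm ℤ} (hπ : π ∈ evenSignedPerm (n + 1)) :
    1 ≤ |π⁻¹ ((n : ℤ) + 1)| ∧ |π⁻¹ ((n : ℤ) + 1)| ≤ (n : ℤ) + 1 := by
  have := Finset.mem_Icc.1 (abs_mem (inv_mem hπ).1 (i := (n : ℤ) + 1) (by simp))
  exact_mod_cast this

/-- The word of `σ` with `n + 1` inserted at position `|i|`, with the sign of `i`. -/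
noncomputable def insertTop (n : ℕ) (i : ℤ) (h1 : 1 ≤ |i|) (h2 : |i| ≤ (n : ℤ) + 1)
    (σ : Equiv.Perm ℤ) : Equiv.Perm ℤ :=
  negTop ((n : ℤ) + 1) i * σ * shiftCycle |i| ((n : ℤ) + 1) h1 h2

section

variable {n : ℕ} {i : ℤ} {h1 : 1 ≤ |i|} {h2 : |i| ≤ (n : ℤ) + 1} {σ π : Equiv.Perm ℤ}

theorem insertTop_mem (hn : 1 ≤ n) (hσ : σ ∈ evenSignedPerm n) :
    insertTop n i h1 h2 σ ∈ evenSignedPerm (n + 1) := by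
  have hs := negTop_mem (n := n + 1) (by omega) i
  have hc := shiftCycle_mem (n := n + 1) h1 (by push_cast; exact h2)
  push_cast at hs hc
  exact mul_mem (mul_mem hs (evenSignedPerm_le_succ n hσ)) hc

theorem negTop_shiftCycle_apply (hn : 1 ≤ n) :
    (shiftCycle |i| ((n : ℤ) + 1) h1 h2) i = negTop ((n : ℤ) + 1) i ((n : ℤ) + 1) := by
  rw [negTop_apply (by omega), shiftCycle_apply]
  grind

theorem insertTop_inv_apply (hn : 1 ≤ n) (hσ : σ ∈ evenSignedPerm n) :
    (insertTop n i h1 h2 σ)⁻¹ ((n : ℤ) + 1) = i := by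
  have htop := apply_top hσ
  rw [Equiv.Perm.inv_eq_iff_eq, insertTop, Equiv.Perm.mul_apply, Equiv.Perm.mul_apply,
    negTop_shiftCycle_apply hn]
  have hs : σ (negTop ((n : ℤ) + 1) i ((n : ℤ) + 1)) =
      negTop ((n : ℤ) + 1) i ((n : ℤ) + 1) := by
    rw [negTop_apply (by omega)]
    split_ifs
    · rw [hσ.1.1, htop]
    · exact htop
  have hself := negTop_mul_self (n := n + 1) (by omega) i
  push_cast at hself
  rw [hs, ← Equiv.Perm.mul_apply, hself, Equiv.Perm.one_apply]

/-- Undo both outer factors; what remains fixes `n + 1`, and hence has rank `n`. -/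
theorem exists_insertTop_eq (hn : 1 ≤ n) (hπ : π ∈ evenSignedPerm (n + 1))
    (hi : π⁻¹ ((n : ℤ) + 1) = i) : ∃ σ ∈ evenSignedPerm n, insertTop n i h1 h2 σ = π := by
  have hs := negTop_mem (n := n + 1) (by omega) i
  have hc := shiftCycle_mem (n := n + 1) h1 (by push_cast; exact h2)
  have hself := negTop_mul_self (n := n + 1) (by omega) i
  push_cast at hs hc hself
  refine ⟨negTop ((n : ℤ) + 1) i * π * (shiftCycle |i| ((n : ℤ) + 1) h1 h2)⁻¹,
    mem_of_apply_top (mul_mem (mul_mem hs hπ) (inv_mem hc)) ?_, ?_⟩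
  · have e : (shiftCycle |i| ((n : ℤ) + 1) h1 h2)⁻¹ ((n : ℤ) + 1) = |i| := by
      rw [Equiv.Perm.inv_eq_iff_eq, shiftCycle_apply]; grind
    have hπi : π i = (n : ℤ) + 1 := by rw [← hi]; simp
    rw [Equiv.Perm.mul_apply, Equiv.Perm.mul_apply, e]
    rcases lt_or_ge i 0 with h0 | h0
    · rw [abs_of_neg h0, hπ.1.1, hπi, negTop_apply (by omega), if_pos, neg_neg]
      refine ⟨h0, Or.inr ?_⟩
      rw [abs_neg, abs_of_pos (by omega)]
    · rw [abs_of_nonneg h0, hπi, negTop_apply (by omega), if_neg (by omega)]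
  · rw [insertTop, ← mul_assoc, ← mul_assoc, hself, one_mul, mul_assoc, inv_mul_cancel, mul_one]

theorem insertTop_injective : Function.Injective (insertTop n i h1 h2) := fun a b hab => by
  simpa [insertTop] using hab

theorem tD_top_mem (hn : 1 ≤ n) (h1 : 1 ≤ |i|) (h2 : |i| ≤ (n : ℤ) + 1) :
    tD i ((n : ℤ) + 1) ∈ evenSignedPerm (n + 1) := by
  by_cases hi : i = (n : ℤ) + 1
  · rw [hi, tD_self (by omega)]
    exact one_mem _
  · exact tD_mem (isIndex_top hn h1 h2 hi)

theorem tD_top_apply (hn : 1 ≤ n) (h1 : 1 ≤ |i|) (h2 : |i| ≤ (n : ℤ) + 1) :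
    tD i ((n : ℤ) + 1) ((n : ℤ) + 1) = i := by
  by_cases hi : i = (n : ℤ) + 1
  · rw [hi, tD_self (by omega), Equiv.Perm.one_apply]
  · exact tD_apply_right (isIndex_top hn h1 h2 hi)

theorem tD_top_mul_self (hn : 1 ≤ n) (h1 : 1 ≤ |i|) (h2 : |i| ≤ (n : ℤ) + 1) :
    tD i ((n : ℤ) + 1) * tD i ((n : ℤ) + 1) = 1 := by
  by_cases hi : i = (n : ℤ) + 1
  · rw [hi, tD_self (by omega), mul_one]
  · exact tD_mul_self (isIndex_top hn h1 h2 hi)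

theorem mul_tD_top_inv_apply (hn : 1 ≤ n) (h1 : 1 ≤ |i|) (h2 : |i| ≤ (n : ℤ) + 1)
    (hσ : σ ∈ evenSignedPerm n) : (σ * tD i ((n : ℤ) + 1))⁻¹ ((n : ℤ) + 1) = i := by
  have h := tD_top_apply hn h1 h2
  have h' := congrArg (fun p : Equiv.Perm ℤ => p ((n : ℤ) + 1)) (tD_top_mul_self hn h1 h2)
  simp only [Equiv.Perm.mul_apply, h, Equiv.Perm.one_apply] at h'
  rw [Equiv.Perm.inv_eq_iff_eq, Equiv.Perm.mul_apply, h', apply_top hσ]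

end

theorem eq_one_of_mem_evenSignedPerm_one {π : Equiv.Perm ℤ} (hπ : π ∈ evenSignedPerm 1) :
    π = 1 :=
  eq_one_of_forall_lt hπ (fun s h1 h2 => by push_cast at h2; omega) (fun h => by omega)

/-- All minima and cycle minima lie in `{1}`, so adjoining or deleting `1` makes the sets agree. -/
theorem lengthStats_one : lengthStats 1 1 = sortingStats 1 1 := by
  have hs : sorD 1 1 = 0 := by
    rw [sorD_eq_sum (n := 1) (π := 1) (l := []) ⟨by simp, by simp, rfl⟩]
    rfl
  have hR (t : ZMod 2) : Rmil 1 t 1 ⊆ {1} := by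
    rintro _ ⟨i, h1, h2, -, -, rfl⟩
    obtain rfl : i = 1 := le_antisymm h2 h1
    rfl
  have hC (t : ZMod 2) : Cyc 1 t 1 ⊆ {1} := fun a ha => le_antisymm ha.2.1 ha.1
  have hL : Lmil 1 1 = {1} := by
    ext a
    constructor
    · rintro ⟨i, h1, h2, -, rfl⟩
      obtain rfl : i = 1 := le_antisymm h2 h1
      rfl
    · rintro rfl
      exact ⟨1, le_rfl, le_rfl, fun j hj hj' => by omega, rfl⟩
  have hL' : Lmic 1 = {1} := by
    ext a
    constructor
    · rintro ⟨k, -, -, rfl⟩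
      simp
    · rintro rfl
      exact ⟨1, le_rfl, fun m hm hm' => by omega, by simp⟩
  unfold lengthStats sortingStats RmilPlus RmilMinus CycPlus CycMinus
  rw [hs, invD_one, hL, hL', Set.union_eq_right.2 (hR 0), Set.union_eq_right.2 (hC 0),
    Set.sdiff_eq_empty.2 (hR 1), Set.sdiff_eq_empty.2 (hC 1)]

/-- The successor step removes the largest letter from the word, applies the bijection of rank `n`,
and puts the letter back by a factor `t^D` with the same `i`. -/
theorem exists_bijOn_stats (n : ℕ) (hn : 1 ≤ n) : ∃ φ : Equiv.Perm ℤ → Equiv.Perm ℤ,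
    Set.BijOn φ (evenSignedPerm n) (evenSignedPerm n) ∧
      ∀ π ∈ evenSignedPerm n, lengthStats n π = sortingStats n (φ π) := by
  induction n, hn using Nat.le_induction with
  | base =>
    refine ⟨id, Set.bijOn_id _, fun π hπ => ?_⟩
    rw [eq_one_of_mem_evenSignedPerm_one hπ]
    exact lengthStats_one
  | succ n hn ih =>
    obtain ⟨φ, hφ, hstat⟩ := ih
    have hdec : ∀ π : evenSignedPerm (n + 1), ∃ σ ∈ evenSignedPerm n,
        insertTop n ((π : Equiv.Perm ℤ)⁻¹ ((n : ℤ) + 1)) (inv_apply_top_bounds π.2).1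
          (inv_apply_top_bounds π.2).2 σ = π := fun π => exists_insertTop_eq hn π.2 rfl
    choose rem hrem hins using hdec
    classical
    -- The value `1` outside the group is a dummy.
    let ψ : Equiv.Perm ℤ → Equiv.Perm ℤ := fun π => if h : π ∈ evenSignedPerm (n + 1) then
      φ (rem ⟨π, h⟩) * tD (π⁻¹ ((n : ℤ) + 1)) ((n : ℤ) + 1) else 1
    have hψ : ∀ (π : Equiv.Perm ℤ) (h : π ∈ evenSignedPerm (n + 1)),
        ψ π = φ (rem ⟨π, h⟩) * tD (π⁻¹ ((n : ℤ) + 1)) ((n : ℤ) + 1) := fun π h => dif_pos h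
    have hψm : ∀ (π : Equiv.Perm ℤ) (h : π ∈ evenSignedPerm (n + 1)),
        ψ π ∈ evenSignedPerm (n + 1) := by
      intro π h
      obtain ⟨b1, b2⟩ := inv_apply_top_bounds h
      rw [hψ π h]
      exact mul_mem (evenSignedPerm_le_succ n (hφ.mapsTo (hrem _))) (tD_top_mem hn b1 b2)
    have hψi : ∀ (π : Equiv.Perm ℤ) (h : π ∈ evenSignedPerm (n + 1)),
        (ψ π)⁻¹ ((n : ℤ) + 1) = π⁻¹ ((n : ℤ) + 1) := by
      intro π h
      obtain ⟨b1, b2⟩ := inv_apply_top_bounds h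
      rw [hψ π h]
      exact mul_tD_top_inv_apply hn b1 b2 (hφ.mapsTo (hrem _))
    refine ⟨ψ, ⟨hψm, ?_, ?_⟩, ?_⟩
    · intro π hπ ρ hρ he
      -- The image remembers `i`, so equal images have the same last factor, which cancels.
      have hi : π⁻¹ ((n : ℤ) + 1) = ρ⁻¹ ((n : ℤ) + 1) := by
        rw [← hψi π hπ, ← hψi ρ hρ, he]
      rw [hψ π hπ, hψ ρ hρ, hi] at he
      have he' := hφ.injOn (hrem _) (hrem _) (mul_right_cancel he)
      have e1 := hins ⟨π, hπ⟩
      have e2 := hins ⟨ρ, hρ⟩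
      simp only [hi, he'] at e1 e2
      exact e1.symm.trans e2
    · intro ρ hρ
      obtain ⟨b1, b2⟩ := inv_apply_top_bounds hρ
      set i := ρ⁻¹ ((n : ℤ) + 1) with hidef
      have hρi : ρ i = (n : ℤ) + 1 := by simp [hidef]
      have hm : ρ * tD i ((n : ℤ) + 1) ∈ evenSignedPerm n :=
        mem_of_apply_top (mul_mem hρ (tD_top_mem hn b1 b2))
          (by rw [Equiv.Perm.mul_apply, tD_top_apply hn b1 b2, hρi])
      obtain ⟨σ, hσ, hσ'⟩ := hφ.surjOn hm
      have hπ := insertTop_mem (h1 := b1) (h2 := b2) hn hσ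
      have hπi := insertTop_inv_apply (h1 := b1) (h2 := b2) hn hσ
      refine ⟨insertTop n i b1 b2 σ, hπ, ?_⟩
      have e := hins ⟨_, hπ⟩
      simp only [hπi] at e
      rw [hψ _ hπ, insertTop_injective e, hσ', hπi, mul_assoc, tD_top_mul_self hn b1 b2, mul_one]
    · intro π hπ
      obtain ⟨b1, b2⟩ := inv_apply_top_bounds hπ
      have hm := hψm π hπ
      have hi := isInsertion_mul hn b1 b2 (hrem ⟨π, hπ⟩)
      have e := hins ⟨π, hπ⟩
      rw [insertTop] at e
      rw [e] at hi
      rw [hψ π hπ] at hm ⊢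
      rw [sortingStats_mul_tD hn b1 b2 (hφ.mapsTo (hrem _)) hm,
        lengthStats_insert hn hi (hrem _) hπ, hstat _ (hrem _)]

/-! ### Restriction to the Ferrers shape -/

theorem Lmap_eq_image (n : ℕ) (π : Equiv.Perm ℤ) : Lmap n π = Prod.fst '' lrMaxPairs n π := by
  ext i
  constructor
  · rintro ⟨h1, h2, h3⟩
    exact ⟨(i, |π i|), ⟨h1, h2, h3, rfl⟩, rfl⟩
  · rintro ⟨p, ⟨h1, h2, h3, -⟩, rfl⟩
    exact ⟨h1, h2, h3⟩

theorem Lmal_eq_image (n : ℕ) (π : Equiv.Perm ℤ) : Lmal n π = Prod.snd '' lrMaxPairs n π := by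
  ext a
  constructor
  · rintro ⟨i, h1, h2, h3, rfl⟩
    exact ⟨(i, |π i|), ⟨h1, h2, h3, rfl⟩, rfl⟩
  · rintro ⟨p, ⟨h1, h2, h3, h4⟩, rfl⟩
    exact ⟨p.1, h1, h2, h3, h4⟩

/-- A place that is not a left-to-right maximum has an earlier place with a letter at least as
large, to which strong induction applies. -/
theorem exists_lrMaxPairs_ge {n : ℕ} (π : Equiv.Perm ℤ) {i : ℤ} (h1 : 1 ≤ i) (h2 : i ≤ n) :
    ∃ p ∈ lrMaxPairs n π, p.1 ≤ i ∧ |π i| ≤ p.2 := by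
  induction i using Int.strongRec (m := 1) with
  | lt i hi => omega
  | ge i _ ih =>
    by_cases hc : ∀ j : ℤ, 1 ≤ j → j < i → |π j| < |π i|
    · exact ⟨(i, |π i|), ⟨h1, h2, hc, rfl⟩, le_rfl, le_rfl⟩
    · push Not at hc
      obtain ⟨j, hj1, hj2, hj3⟩ := hc
      obtain ⟨p, hp, hp1, hp2⟩ := ih j hj2 hj1 (by omega)
      exact ⟨p, hp, by omega, by omega⟩

/-- Each letter is bounded by a left-to-right maximum at the same or an earlier place, where the
bound `f` is no larger. -/
theorem mem_restricted_iff {n : ℕ} {f : ℤ → ℤ}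
    (hmono : ∀ i j : ℤ, 1 ≤ i → i ≤ j → j ≤ n → f i ≤ f j) {π : Equiv.Perm ℤ} :
    π ∈ restricted n f ↔ π ∈ evenSignedPerm n ∧ ∀ p ∈ lrMaxPairs n π, p.2 ≤ f p.1 := by
  refine and_congr_right fun _ => ⟨?_, fun h i h1 h2 => ?_⟩
  · rintro h p ⟨h1, h2, -, h4⟩
    rw [← h4]
    exact h p.1 h1 h2
  · obtain ⟨p, hp, hp1, hp2⟩ := exists_lrMaxPairs_ge π h1 h2
    exact hp2.trans ((h p hp).trans (hmono _ _ hp.1 hp1 h2))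

end EvenSigned

theorem theorem6p3 (n : ℕ) (hn : 1 ≤ n) (f : ℤ → ℤ)
    (hf : ∀ i : ℤ, 1 ≤ i → i ≤ n → 1 ≤ f i ∧ f i ≤ n)
    (hmono : ∀ i j : ℤ, 1 ≤ i → i ≤ j → j ≤ n → f i ≤ f j)
    (k : ℤ) (A B C P M : Set ℤ) :
    {π ∈ EvenSigned.restricted n f |
      (EvenSigned.length n π : ℤ) = k ∧ EvenSigned.RmilPlus n π = A ∧
      EvenSigned.RmilMinus n π = B ∧ EvenSigned.Lmil n π = C ∧
      EvenSigned.Lmap n π = P ∧ EvenSigned.Lmal n π = M}.encard =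
    {π ∈ EvenSigned.restricted n f |
      EvenSigned.sorD n π = k ∧ EvenSigned.CycPlus n π = A ∧
      EvenSigned.CycMinus n π = B ∧ EvenSigned.Lmic π = C ∧
      EvenSigned.Lmap n π = P ∧ EvenSigned.Lmal n π = M}.encard := by
  obtain ⟨φ, hφ, hstat⟩ := EvenSigned.exists_bijOn_stats n hn
  have key : ∀ π ∈ EvenSigned.evenSignedPerm n,
      (π ∈ {π ∈ EvenSigned.restricted n f |
        (EvenSigned.length n π : ℤ) = k ∧ EvenSigned.RmilPlus n π = A ∧
        EvenSigned.RmilMinus n π = B ∧ EvenSigned.Lmil n π = C ∧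
        EvenSigned.Lmap n π = P ∧ EvenSigned.Lmal n π = M} ↔
      φ π ∈ {π ∈ EvenSigned.restricted n f |
        EvenSigned.sorD n π = k ∧ EvenSigned.CycPlus n π = A ∧
        EvenSigned.CycMinus n π = B ∧ EvenSigned.Lmic π = C ∧
        EvenSigned.Lmap n π = P ∧ EvenSigned.Lmal n π = M}) := by
    intro π hπ
    have h := hstat π hπ
    simp only [EvenSigned.lengthStats, EvenSigned.sortingStats, Prod.mk.injEq] at h
    obtain ⟨h1, h2, h3, h4, h5⟩ := h
    have hφπ : φ π ∈ EvenSigned.evenSignedPerm n := hφ.mapsTo hπ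
    simp only [Set.mem_ofPred_eq, EvenSigned.mem_restricted_iff hmono,
      EvenSigned.Lmap_eq_image, EvenSigned.Lmal_eq_image, EvenSigned.length_eq_invD hπ,
      h1, h2, h3, h4, h5, hπ, hφπ]
  rw [← (hφ.injOn.mono fun π hπ => hπ.1.1 : Set.InjOn φ {π ∈ EvenSigned.restricted n f |
    (EvenSigned.length n π : ℤ) = k ∧ EvenSigned.RmilPlus n π = A ∧
    EvenSigned.RmilMinus n π = B ∧ EvenSigned.Lmil n π = C ∧
    EvenSigned.Lmap n π = P ∧ EvenSigned.Lmal n π = M}).encard_image]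
  congr 1
  ext ρ
  constructor
  · rintro ⟨π, hπ, rfl⟩
    exact (key π hπ.1.1).1 hπ
  · intro hρ
    obtain ⟨π, hπ, rfl⟩ := hφ.surjOn hρ.1.1
    exact ⟨π, (key π hπ).2 hρ, rfl⟩
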